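/- Let $Sp(2)=\{A\in SU(4): AJA^{T}=J\}$ with $J=\begin{pmatrix}0&-I_2\\ I_2&0\end{pmatrix}$, let $$H=\Big\{\begin{pmatrix} zA&0\\0&\bar z^{4}\end{pmatrix}: A\in Sp(2),\ z\in S^1\subset\mathbb C\Big\}\subset L:=S(U(4)\times U(1))\subset SU(5),$$ let $\iota:SU(4)\to L$, $\iota(A)=\begin{pmatrix}A&0\\0&1\end{pmatrix}$, be the standard inclusion, write $SU(4)\cap H:=\iota^{-1}(H)$, and let $B^{13}=SU(5)/H$. All coset spaces and projective spaces carry their standard quotient smooth structures. For closed subgroups $K\subset L$ of a Lie group $G$, the projection $G/K\to G/L$, $gK\mapsto gL$, is called a *homogeneous fibration* with fiber $L/K$ and structural group $L$ if it is smooth and $G$-equivariant and is a locally trivial smooth fiber bundle with typical fiber $L/K$, having an atlas of smooth local trivializations in which the changes of trivialization, and more generally the left translations by elements of $G$, act in the fibers through smooth families of elements of $L$ acting on $L/K$ from the left. **Proposition.** The subgroups $H\subset L$ are closed, and the projection $\pi:B^{13}\to SU(5)/L$, $gH\mapsto gL$, is a homogeneous fibration with fiber $L/H$ and structural group $L$.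 Moreover: 1. the base is $\mathbb CP^4$: $gL\mapsto[g e_5]$ is a diffeomorphism $SU(5)/L\to\mathbb CP^4$; 2. the inclusion $\iota$ induces a diffeomorphism $SU(4)/(SU(4)\cap H)\to S(U(4)\times U(1))/H$, $a\,(SU(4)\cap H)\mapsto\iota(a)H$; 3. $SU(4)/(SU(4)\cap H)$ is diffeomorphic to $\mathbb RP^5$; 4. the fibers are obtained by the action of $SU(5)$ on $SU(4)/(SU(4)\cap H)$: for every $g\in SU(5)$ the map $a\,(SU(4)\cap H)\mapsto g\,\iota(a)H$ is a diffeomorphism of $SU(4)/(SU(4)\cap H)$ onto the fiber $\pi^{-1}(gL)$. In particular there is a homogeneous fibration $\mathbb RP^5\to B^{13}\to\mathbb CP^4$. -/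

import Mathlib

open scoped Matrix ContDiff LinearAlgebra.Projectivization

noncomputable section

namespace Berger

/-! ### Smooth structures

Smoothness is expressed through diffeologies. A smooth manifold is regarded as the diffeological
space whose plots are the smooth maps from the spaces `ℝⁿ`; a map of manifolds is smooth in the
usual sense if and only if it sends plots to plots (`Diffeology.DSmooth`). An embedded submanifold
carries the subspace diffeology, a product manifold the product diffeology, and the base of a
surjective submersion (such as a quotient of a Lie group by a closed subgroup) the quotient
diffeology. -/

section Diffeology

open Diffeology

variable {X Y : Type*}

/-- The diffeology pulled back along `f : X → Y`: a map `p` into `X` is a plot iff `f ∘ p` is. -/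
@[reducible] def inducedDiffeology (dY : DiffeologicalSpace Y) (f : X → Y) :
    DiffeologicalSpace X where
  plots _ := {p | IsPlot (f ∘ p)}
  constant_plots x := isPlot_const (x := f x)
  plot_reparam {_ _ p r} hp hr := isPlot_reparam (p := f ∘ p) (f := r) hp hr
  locality {_ p} hp := dY.locality (p := f ∘ p) fun x => by
    obtain ⟨u, hu, hx, h⟩ := hp x
    exact ⟨u, hu, hx, fun hr hr' => h hr hr'⟩

/-- The diffeology pushed forward along `f : X → Y`: the finest one for which `f` is smooth. -/
@[reducible] def coinducedDiffeology (dX : DiffeologicalSpace X) (f : X → Y) :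
    DiffeologicalSpace Y :=
  DiffeologicalSpace.generateFrom
    {p | ∃ q : EuclideanSpace ℝ (Fin p.1) → X, IsPlot q ∧ p.2 = f ∘ q}

instance subtypeDiffeology {P : X → Prop} [dX : DiffeologicalSpace X] :
    DiffeologicalSpace {x // P x} :=
  inducedDiffeology dX Subtype.val

instance prodDiffeology [dX : DiffeologicalSpace X] [dY : DiffeologicalSpace Y] :
    DiffeologicalSpace (X × Y) :=
  inducedDiffeology dX Prod.fst ⊓ inducedDiffeology dY Prod.snd

/-- The smooth structure of a coset space `G ⧸ K`. -/
instance cosetDiffeology {G : Type*} [Group G] [dG : DiffeologicalSpace G] (K : Subgroup G) :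
    DiffeologicalSpace (G ⧸ K) :=
  coinducedDiffeology dG QuotientGroup.mk

/-- Complex matrices as a finite-dimensional real vector space. -/
instance matrixDiffeology {m n : Type*} [Fintype m] [Fintype n] :
    DiffeologicalSpace (Matrix m n ℂ) :=
  inducedDiffeology (NormedSpace.toDiffeology (m → n → ℂ)) fun A i j => A i j

/-- A map is smooth on a subset `s` if its restriction to `s`, with the subspace diffeology,
is smooth. -/
def DSmoothOn [DiffeologicalSpace X] [DiffeologicalSpace Y] (f : X → Y) (s : Set X) : Prop :=
  DSmooth fun x : s => f x

/-- Diffeomorphisms: homeomorphisms which are smooth in both directions. -/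
structure Diffeo (X Y : Type*) [TopologicalSpace X] [DiffeologicalSpace X]
    [TopologicalSpace Y] [DiffeologicalSpace Y] extends X ≃ₜ Y where
  smooth_toFun : DSmooth toFun
  smooth_invFun : DSmooth invFun

end Diffeology

/-! ### Projective spaces -/

section Projective

variable (K V : Type*) [Field K] [NormedAddCommGroup V] [Module K V]

/-- The quotient topology from the space of nonzero vectors. -/
instance projectiveTopology : TopologicalSpace (ℙ K V) :=
  TopologicalSpace.coinduced (Projectivization.mk' K) inferInstance

/-- The quotient smooth structure from the manifold of nonzero vectors. -/
instance projectiveDiffeology [NormedSpace ℝ V] [FiniteDimensional ℝ V] :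
    DiffeologicalSpace (ℙ K V) :=
  coinducedDiffeology (inducedDiffeology (NormedSpace.toDiffeology V) Subtype.val)
    (Projectivization.mk' K (V := V))

end Projective

/-! ### Homogeneous fibrations -/

section Fibration

variable {G : Type*} [Group G] [TopologicalSpace G] [DiffeologicalSpace G]

/-- For closed subgroups `K ≤ L` of `G`, the projection `G ⧸ K → G ⧸ L`, `gK ↦ gL`, is a
homogeneous fibration with fibre `L ⧸ K` and structural group `L`: it is a smooth `G`-equivariant
map which has an atlas of local trivializations with fibre `L ⧸ K` that are diffeomorphisms, and
in which each element of `G` (in particular `1`, which gives the changes of trivialization) acts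
in the fibres through a smooth family of elements of `L`. -/
structure IsHomogeneousFibration (K L : Subgroup G) (hKL : K ≤ L) : Prop where
  isClosed_left : IsClosed (K : Set G)
  isClosed_right : IsClosed (L : Set G)
  smooth : Diffeology.DSmooth (Subgroup.quotientMapOfLE hKL)
  equivariant : ∀ (g : G) (x : G ⧸ K),
    Subgroup.quotientMapOfLE hKL (g • x) = g • Subgroup.quotientMapOfLE hKL x
  exists_atlas : ∃ 𝒜 : Set (Bundle.Trivialization (L ⧸ K.subgroupOf L)
      (Subgroup.quotientMapOfLE hKL)),
    (∀ b : G ⧸ L, ∃ e ∈ 𝒜, b ∈ e.baseSet) ∧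
    (∀ e ∈ 𝒜, DSmoothOn e e.source ∧
      DSmoothOn e.toOpenPartialHomeomorph.symm e.target) ∧
    ∀ e ∈ 𝒜, ∀ e' ∈ 𝒜, ∀ g : G, ∃ t : G ⧸ L → L,
      DSmoothOn t {b | b ∈ e.baseSet ∧ g • b ∈ e'.baseSet} ∧
      ∀ b ∈ e.baseSet, g • b ∈ e'.baseSet → ∀ x : L ⧸ K.subgroupOf L,
        e' (g • e.toOpenPartialHomeomorph.symm (b, x)) = (g • b, t b • x)

end Fibration

/-! ### The groups -/

/-- `SU(4)`, with the coordinates of `ℂ⁴` indexed by `Fin 2 ⊕ Fin 2`. -/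
abbrev SU4 : Type := Matrix.specialUnitaryGroup (Fin 2 ⊕ Fin 2) ℂ

/-- `SU(5)`, with the coordinates of `ℂ⁵ = ℂ⁴ × ℂ` indexed by `(Fin 2 ⊕ Fin 2) ⊕ Unit`. -/
abbrev SU5 : Type := Matrix.specialUnitaryGroup ((Fin 2 ⊕ Fin 2) ⊕ Unit) ℂ

/-- The compact symplectic group `Sp(2) = U(4) ∩ Sp(4, ℂ)`, as a subgroup of `SU(4)`. -/
def Sp2 : Subgroup SU4 where
  carrier := {A | A.1 ∈ Matrix.symplecticGroup (Fin 2) ℂ}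
  mul_mem' {A B} hA hB := (Matrix.symplecticGroup (Fin 2) ℂ).mul_mem (x := A.1) (y := B.1) hA hB
  one_mem' := (Matrix.symplecticGroup (Fin 2) ℂ).one_mem
  inv_mem' {A} hA := by
    have h1 : star A.1 * A.1 = 1 := A.2.1.1
    have h2 : A.1ᵀ * (star A.1)ᵀ = 1 := by rw [← Matrix.transpose_mul, h1, Matrix.transpose_one]
    have h3 : A.1 * Matrix.J (Fin 2) ℂ * A.1ᵀ = Matrix.J (Fin 2) ℂ := hA
    change star A.1 * Matrix.J (Fin 2) ℂ * (star A.1)ᵀ = Matrix.J (Fin 2) ℂ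
    conv_lhs => rw [← h3]
    calc star A.1 * (A.1 * Matrix.J (Fin 2) ℂ * A.1ᵀ) * (star A.1)ᵀ
        = (star A.1 * A.1) * Matrix.J (Fin 2) ℂ * (A.1ᵀ * (star A.1)ᵀ) := by
          simp only [mul_assoc]
      _ = Matrix.J (Fin 2) ℂ := by rw [h1, h2, one_mul, mul_one]

/-- `S(U(4) × U(1))`, the group of block diagonal matrices in `SU(5)`. -/
def SU4U1 : Subgroup SU5 where
  carrier := {g | ∃ A ∈ Matrix.unitaryGroup (Fin 2 ⊕ Fin 2) ℂ, ∃ d ∈ Matrix.unitaryGroup Unit ℂ,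
    g.1 = Matrix.fromBlocks A 0 0 d}
  mul_mem' := by
    rintro g g' ⟨A, hA, d, hd, h⟩ ⟨A', hA', d', hd', h'⟩
    refine ⟨A * A', mul_mem hA hA', d * d', mul_mem hd hd', ?_⟩
    change g.1 * g'.1 = _
    rw [h, h', Matrix.fromBlocks_multiply]
    simp
  one_mem' := ⟨1, one_mem _, 1, one_mem _, Matrix.fromBlocks_one.symm⟩
  inv_mem' := by
    rintro g ⟨A, hA, d, hd, h⟩
    refine ⟨star A, Unitary.star_mem hA, star d, Unitary.star_mem hd, ?_⟩
    change star g.1 = _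
    rw [h, Matrix.star_eq_conjTranspose, Matrix.fromBlocks_conjTranspose]
    simp [Matrix.star_eq_conjTranspose]

/-- The isotropy group of the Berger space: all matrices `diag(z A, z̄⁴)` with `A ∈ Sp(2)`
and `z` in the unit circle. -/
def H : Subgroup SU5 where
  carrier := {g | ∃ A ∈ Sp2, ∃ z : Circle,
    g.1 = Matrix.fromBlocks ((z : ℂ) • A.1) 0 0
      (star (z : ℂ) ^ 4 • (1 : Matrix Unit Unit ℂ))}
  mul_mem' := by
    rintro g g' ⟨A, hA, z, h⟩ ⟨A', hA', z', h'⟩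
    refine ⟨A * A', mul_mem hA hA', z * z', ?_⟩
    change g.1 * g'.1 = _
    rw [h, h', Matrix.fromBlocks_multiply]
    simp [smul_smul, mul_pow, mul_comm]
  one_mem' := ⟨1, one_mem _, 1, by simp⟩
  inv_mem' := by
    rintro g ⟨A, hA, z, h⟩
    refine ⟨A⁻¹, inv_mem hA, z⁻¹, ?_⟩
    change star g.1 = _
    have hA' : (A⁻¹).1 = A.1ᴴ := rfl
    have hz : ((z⁻¹ : Circle) : ℂ) = star (z : ℂ) := Circle.coe_inv_eq_conj z
    rw [h, Matrix.star_eq_conjTranspose, Matrix.fromBlocks_conjTranspose, hA', hz]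
    simp

theorem H_le : H ≤ SU4U1 := by
  rintro g ⟨A, hA, z, h⟩
  have hz : (z : ℂ) * star (z : ℂ) = 1 := by
    simp [Complex.mul_conj]
  refine ⟨_, ?_, _, ?_, h⟩
  · rw [Matrix.mem_unitaryGroup_iff]
    have h1 : A.1 * star A.1 = 1 := A.2.1.2
    rw [star_smul, smul_mul_smul_comm, h1, hz, one_smul]
  · rw [Matrix.mem_unitaryGroup_iff, star_smul, smul_mul_smul_comm, star_pow, star_star,
      ← mul_pow, mul_comm, hz]
    simp

/-- The standard inclusion `SU(4) → SU(5)`, `A ↦ diag(A, 1)`. -/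
def inclSU4 : SU4 →* SU5 where
  toFun A := ⟨Matrix.fromBlocks A.1 0 0 1, by
    refine ⟨?_, ?_⟩
    · have h1 : A.1 * star A.1 = 1 := A.2.1.2
      change _ ∈ Matrix.unitaryGroup _ _
      rw [Matrix.mem_unitaryGroup_iff, Matrix.star_eq_conjTranspose,
        Matrix.fromBlocks_conjTranspose, Matrix.fromBlocks_multiply]
      rw [Matrix.star_eq_conjTranspose] at h1
      simp [h1]
    · have h2 : A.1.det = 1 := A.2.2
      change Matrix.det (Matrix.fromBlocks A.1 0 0 (1 : Matrix Unit Unit ℂ)) = 1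
      simp [h2]⟩
  map_one' := Subtype.ext Matrix.fromBlocks_one
  map_mul' A B := Subtype.ext <| by
    change Matrix.fromBlocks (A.1 * B.1) 0 0 (1 : Matrix Unit Unit ℂ) =
      Matrix.fromBlocks A.1 0 0 1 * Matrix.fromBlocks B.1 0 0 1
    simp [Matrix.fromBlocks_multiply]

theorem inclSU4_mem (A : SU4) : inclSU4 A ∈ SU4U1 :=
  ⟨A.1, A.2.1, 1, one_mem _, rfl⟩

/-- The subgroup `SU(4) ∩ H` of `SU(4)`. -/
abbrev SU4capH : Subgroup SU4 := H.comap inclSU4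

/-- The Berger space `B¹³ = SU(5) / H`. -/
abbrev B13 : Type := SU5 ⧸ H

/-- The projection `B¹³ → SU(5) / S(U(4) × U(1))`, `gH ↦ g S(U(4) × U(1))`. -/
abbrev proj : B13 → SU5 ⧸ SU4U1 := Subgroup.quotientMapOfLE H_le

end Berger

end

/-!
All four identifications come from one principle. Let `F : G → X` be a continuous smooth map on a
compact group whose fibres are the cosets of a closed subgroup `K`, with `X` Hausdorff. If every
plot of `X` lifts locally to a plot of `G`, then `F` induces a diffeomorphism `G ⧸ K → X`
(`exists_diffeo_of_local_lifts`): compactness makes it a homeomorphism, and the local lifts make its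
inverse smooth. So what has to be found are explicit smooth local lifts.

* For `SU(5) → ℂP⁴`, `g ↦ [g e₅]`, a unit vector `u ≠ -e₅` is the image of `e₅` under the negative
  of a complex reflection depending smoothly on `u`, whose determinant can be normalized without
  changing the last column (`columnMatrix`). Of the two unit vectors `±u` at least one is not `-e₅`.
* For `SU(4) → ℝP⁵`, the group acts by `S ↦ A S Aᵀ` on a six-dimensional real space of
  skew-symmetric matrices (`skew`), namely those whose Hodge star is their conjugate transpose. The
  space is preserved because the Pfaffian of `A J Aᵀ` is that of `J` times `det A`
  (`skew_coords`), and the stabilizer of the line through `J` is `Sp(2) ∪ i Sp(2) = SU(4) ∩ H`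
  (`inv_mul_mem_SU4capH_iff`). A direction `v ≠ -J` is reached from `J` by the Clifford product of
  `J` with the bisector of `v` and `J` (`bisectorMatrix`).
* For `SU(4) → L ⧸ H`, and likewise for the maps onto the fibres of `SU(5) ⧸ H → SU(5) ⧸ L`, an
  element `diag(A, d)` of `L` is congruent to `diag(r A, 1)` modulo `H` whenever `r⁴ = d`, and fourth
  roots can be chosen smoothly near a given point (`exists_isPlotAt_SU4`).

The homogeneous fibration is obtained from a single smooth section `σ` of `SU(5) → SU(5) ⧸ L` near
the base point (`exists_localSection`): its translates trivialize the projection by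
`gH ↦ (gL, σ(gL)⁻¹ g H)`, and any `g` acts between two such trivializations through the elements
`σ'(g b)⁻¹ g σ(b)` of `L` (`LocalSection.isHomogeneousFibration`). The section is the lift above,
applied to the last column of `g` rotated so that its last entry is positive.

Smoothness is checked through germs of plots (`IsPlotAt`), for which the plots of a quotient are
exactly the maps that locally lift (`exists_isPlotAt_lift`).
-/

noncomputable section

open Diffeology Topology Filter

namespace Berger

/-! ### Germs of plots -/

section Germs

variable {X Y : Type*} {n m : ℕ}

/-- A map `p : ℝⁿ → X` is a plot near `x` if some neighbourhood `u` of `x` is such that `p` becomes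
a plot after any smooth reparametrization with values in `u`. This is the hypothesis of the
locality axiom, so a map which is a plot near every point is a plot. -/
def IsPlotAt [DiffeologicalSpace X] (p : EuclideanSpace ℝ (Fin n) → X)
    (x : EuclideanSpace ℝ (Fin n)) : Prop :=
  ∃ u : Set (EuclideanSpace ℝ (Fin n)), IsOpen u ∧ x ∈ u ∧
    ∀ {m : ℕ} {f : EuclideanSpace ℝ (Fin m) → EuclideanSpace ℝ (Fin n)},
      (∀ y, f y ∈ u) → ContDiff ℝ ∞ f → IsPlot (p ∘ f)

theorem _root_.Diffeology.IsPlot.isPlotAt [DiffeologicalSpace X]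
    {p : EuclideanSpace ℝ (Fin n) → X} (hp : IsPlot p) (x : EuclideanSpace ℝ (Fin n)) :
    IsPlotAt p x :=
  ⟨Set.univ, isOpen_univ, trivial, fun _ hf => isPlot_reparam hp hf⟩

theorem isPlot_of_isPlotAt [DiffeologicalSpace X] {p : EuclideanSpace ℝ (Fin n) → X}
    (h : ∀ x, IsPlotAt p x) : IsPlot p :=
  DiffeologicalSpace.locality h

theorem IsPlotAt.congr [DiffeologicalSpace X] {p q : EuclideanSpace ℝ (Fin n) → X}
    {x : EuclideanSpace ℝ (Fin n)} (hp : IsPlotAt p x) (h : p =ᶠ[𝓝 x] q) : IsPlotAt q x := by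
  obtain ⟨u, hu, hxu, hp⟩ := hp
  obtain ⟨v, hv, hvo, hxv⟩ := mem_nhds_iff.1 h
  refine ⟨u ∩ v, hu.inter hvo, ⟨hxu, hxv⟩, fun {m f} hf hf' => ?_⟩
  have : q ∘ f = p ∘ f := funext fun y => (hv (hf y).2).symm
  rw [this]
  exact hp (fun y => (hf y).1) hf'

theorem IsPlotAt.comp_contDiffOn [DiffeologicalSpace X] {p : EuclideanSpace ℝ (Fin n) → X}
    {φ : EuclideanSpace ℝ (Fin m) → EuclideanSpace ℝ (Fin n)} {x : EuclideanSpace ℝ (Fin m)}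
    {v : Set (EuclideanSpace ℝ (Fin m))} (hp : IsPlotAt p (φ x)) (hv : IsOpen v) (hx : x ∈ v)
    (hφ : ContDiffOn ℝ ∞ φ v) : IsPlotAt (p ∘ φ) x := by
  obtain ⟨u, hu, hxu, hp⟩ := hp
  refine ⟨v ∩ φ ⁻¹' u, hφ.continuousOn.isOpen_inter_preimage hv hu, ⟨hx, hxu⟩,
    fun {k f} hf hf' => ?_⟩
  exact hp (f := φ ∘ f) (fun y => (hf y).2)
    (contDiffOn_univ.1 (hφ.comp hf'.contDiffOn fun y _ => (hf y).1))

theorem IsPlotAt.comp_dSmooth [DiffeologicalSpace X] [DiffeologicalSpace Y]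
    {p : EuclideanSpace ℝ (Fin n) → X} {x : EuclideanSpace ℝ (Fin n)} (hp : IsPlotAt p x)
    {f : X → Y} (hf : DSmooth f) : IsPlotAt (fun y => f (p y)) x := by
  obtain ⟨u, hu, hxu, hp⟩ := hp
  exact ⟨u, hu, hxu, fun hg hg' => hf _ _ (hp hg hg')⟩

theorem IsPlotAt.comp_dSmoothOn [DiffeologicalSpace X] [DiffeologicalSpace Y]
    {p : EuclideanSpace ℝ (Fin n) → X} {x : EuclideanSpace ℝ (Fin n)} (hp : IsPlotAt p x)
    {f : X → Y} {s : Set X} (hf : DSmoothOn f s) (hs : ∀ᶠ y in 𝓝 x, p y ∈ s) :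
    IsPlotAt (fun y => f (p y)) x := by
  obtain ⟨u, hu, hxu, hp⟩ := hp
  obtain ⟨v, hv, hvo, hxv⟩ := mem_nhds_iff.1 hs
  exact ⟨u ∩ v, hu.inter hvo, ⟨hxu, hxv⟩, fun {m g} hg hg' =>
    hf m (fun y => ⟨p (g y), hv (hg y).2⟩) (hp (fun y => (hg y).1) hg')⟩

theorem dSmooth_of_isPlotAt [DiffeologicalSpace X] [DiffeologicalSpace Y] {f : X → Y}
    (h : ∀ (n : ℕ) (p : EuclideanSpace ℝ (Fin n) → X), IsPlot p → ∀ x,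
      IsPlotAt (fun y => f (p y)) x) : DSmooth f :=
  fun n p hp => isPlot_of_isPlotAt (h n p hp)

/-- To check smoothness on a subset it suffices to consider the plots with values in it. -/
theorem dSmoothOn_of_isPlotAt [DiffeologicalSpace X] [DiffeologicalSpace Y] {f : X → Y}
    {s : Set X} (h : ∀ (n : ℕ) (p : EuclideanSpace ℝ (Fin n) → X), IsPlot p → (∀ y, p y ∈ s) →
      ∀ x, IsPlotAt (fun y => f (p y)) x) : DSmoothOn f s :=
  fun n p hp => isPlot_of_isPlotAt (h n (fun y => (p y).1) hp fun y => (p y).2)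

theorem dSmooth_fst [DiffeologicalSpace X] [DiffeologicalSpace Y] :
    DSmooth (Prod.fst : X × Y → X) :=
  fun _ _ hp => (DiffeologicalSpace.isPlot_inf_iff.1 hp).1

theorem dSmooth_snd [DiffeologicalSpace X] [DiffeologicalSpace Y] :
    DSmooth (Prod.snd : X × Y → Y) :=
  fun _ _ hp => (DiffeologicalSpace.isPlot_inf_iff.1 hp).2

theorem IsPlotAt.prodMk [DiffeologicalSpace X] [DiffeologicalSpace Y]
    {p : EuclideanSpace ℝ (Fin n) → X} {q : EuclideanSpace ℝ (Fin n) → Y}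
    {x : EuclideanSpace ℝ (Fin n)} (hp : IsPlotAt p x) (hq : IsPlotAt q x) :
    IsPlotAt (fun y => (p y, q y)) x := by
  obtain ⟨u, hu, hxu, hp⟩ := hp
  obtain ⟨v, hv, hxv, hq⟩ := hq
  exact ⟨u ∩ v, hu.inter hv, ⟨hxu, hxv⟩, fun h h' => DiffeologicalSpace.isPlot_inf_iff.2
    ⟨hp (fun y => (h y).1) h', hq (fun y => (h y).2) h'⟩⟩

/-- In a normed space the plots near `x` are the maps which are smooth near `x`. -/
theorem isPlotAt_iff_contDiffAt {V : Type*} [NormedAddCommGroup V] [NormedSpace ℝ V]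
    [FiniteDimensional ℝ V] {p : EuclideanSpace ℝ (Fin n) → V} {x : EuclideanSpace ℝ (Fin n)} :
    @IsPlotAt V n (NormedSpace.toDiffeology V) p x ↔ ∀ᶠ y in 𝓝 x, ContDiffAt ℝ ∞ p y := by
  let _ := NormedSpace.toDiffeology V
  constructor
  · rintro ⟨u, hu, hxu, hp⟩
    obtain ⟨r, hr, hru⟩ := Metric.isOpen_iff.1 hu x hxu
    have h1 : ContDiff ℝ ∞ (p ∘ OpenPartialHomeomorph.univBall x r) :=
      hp (fun y => hru (by
        have := (OpenPartialHomeomorph.univBall x r).map_source (x := y) (by simp)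
        rwa [OpenPartialHomeomorph.univBall_target x hr] at this))
        OpenPartialHomeomorph.contDiff_univBall
    filter_upwards [Metric.ball_mem_nhds x hr] with y hy
    have h2 : ContDiffAt ℝ ∞ ((p ∘ OpenPartialHomeomorph.univBall x r) ∘
        (OpenPartialHomeomorph.univBall x r).symm) y :=
      h1.contDiffAt.comp y ((OpenPartialHomeomorph.contDiffOn_univBall_symm (c := x) (r := r) y
        hy).contDiffAt (Metric.isOpen_ball.mem_nhds hy))
    refine h2.congr_of_eventuallyEq ?_
    filter_upwards [Metric.isOpen_ball.mem_nhds hy] with z hz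
    simp only [Function.comp_apply]
    rw [(OpenPartialHomeomorph.univBall x r).right_inv
      (by rwa [OpenPartialHomeomorph.univBall_target x hr])]
  · intro h
    obtain ⟨u, hu, huo, hxu⟩ := mem_nhds_iff.1 h
    exact ⟨u, huo, hxu, fun {m f} hf hf' =>
      contDiff_iff_contDiffAt.2 fun y =>
        ContDiffAt.comp y (show ContDiffAt ℝ ∞ p (f y) from hu (hf y)) hf'.contDiffAt⟩

/-- The plots of a pushforward along a surjection are the maps which locally lift to plots. -/
theorem exists_isPlotAt_lift {dX : DiffeologicalSpace X} {f : X → Y}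
    (hf : Function.Surjective f) {p : EuclideanSpace ℝ (Fin n) → Y}
    (hp : @IsPlot Y (coinducedDiffeology dX f) n p) (x : EuclideanSpace ℝ (Fin n)) :
    ∃ q : EuclideanSpace ℝ (Fin n) → X, IsPlotAt q x ∧ ∀ᶠ y in 𝓝 x, f (q y) = p y := by
  -- The locally liftable maps form a diffeology, which contains the generating plots. Given a lift
  -- `q` of `p` composed with a diffeomorphism of `ℝⁿ` onto a ball, its composition with the inverse
  -- is a lift of `p` on the ball.
  let d : DiffeologicalSpace Y :=
    { plots := fun n => {p | ∀ x, ∃ q : EuclideanSpace ℝ (Fin n) → X,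
        IsPlotAt q x ∧ ∀ᶠ y in 𝓝 x, f (q y) = p y}
      constant_plots := fun y x => by
        obtain ⟨z, rfl⟩ := hf y
        exact ⟨fun _ => z, isPlot_const.isPlotAt x, .of_forall fun _ => rfl⟩
      plot_reparam := fun {n m p g} hp hg x => by
        obtain ⟨q, hq, hqp⟩ := hp (g x)
        exact ⟨q ∘ g, hq.comp_contDiffOn isOpen_univ trivial hg.contDiffOn,
          hg.continuous.continuousAt.eventually hqp⟩
      locality := fun {n p} hp x => by
        obtain ⟨u, hu, hxu, hp⟩ := hp x
        obtain ⟨r, hr, hru⟩ := Metric.isOpen_iff.1 hu x hxu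
        obtain ⟨q, hq, hqp⟩ := hp (f := OpenPartialHomeomorph.univBall x r) (fun y => hru (by
          have := (OpenPartialHomeomorph.univBall x r).map_source (x := y) (by simp)
          rwa [OpenPartialHomeomorph.univBall_target x hr] at this))
          OpenPartialHomeomorph.contDiff_univBall ((OpenPartialHomeomorph.univBall x r).symm x)
        have hxb := Metric.mem_ball_self (x := x) hr
        refine ⟨q ∘ (OpenPartialHomeomorph.univBall x r).symm,
          hq.comp_contDiffOn Metric.isOpen_ball hxb
            OpenPartialHomeomorph.contDiffOn_univBall_symm, ?_⟩
        have hc : ContinuousAt (OpenPartialHomeomorph.univBall x r).symm x :=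
          (OpenPartialHomeomorph.contDiffOn_univBall_symm (n := 0)
            |>.continuousOn.continuousAt (Metric.ball_mem_nhds x hr))
        filter_upwards [hc.eventually hqp, Metric.ball_mem_nhds x hr] with y hy hyb
        simp only [Function.comp_apply] at hy ⊢
        rw [hy, (OpenPartialHomeomorph.univBall x r).right_inv
          (by rwa [OpenPartialHomeomorph.univBall_target x hr])] }
  refine hp d ?_ x
  rintro ⟨n, p⟩ ⟨q, hq, hpq⟩ x
  exact ⟨q, hq.isPlotAt x, .of_forall fun y => (congrFun hpq y).symm⟩

theorem dSmooth_coinduced (dX : DiffeologicalSpace X) (f : X → Y) :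
    @DSmooth X Y dX (coinducedDiffeology dX f) f :=
  fun _ p hp => DiffeologicalSpace.isPlot_generatedFrom_of_mem ⟨p, hp, rfl⟩

end Germs

/-! ### Diffeological groups and their coset spaces -/

/-- A group with a diffeology for which multiplication and inversion are smooth. -/
class IsDiffeologicalGroup (G : Type*) [Group G] [DiffeologicalSpace G] : Prop where
  dSmooth_mul : DSmooth fun p : G × G => p.1 * p.2
  dSmooth_inv : DSmooth fun g : G => g⁻¹

section Cosets

variable {n : ℕ} {G : Type*} [Group G] [DiffeologicalSpace G]

theorem dSmooth_mk (K : Subgroup G) : DSmooth (QuotientGroup.mk : G → G ⧸ K) :=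
  dSmooth_coinduced _ _

theorem exists_isPlotAt_lift_coset {K : Subgroup G} {p : EuclideanSpace ℝ (Fin n) → G ⧸ K}
    (hp : IsPlot p) (x : EuclideanSpace ℝ (Fin n)) :
    ∃ q : EuclideanSpace ℝ (Fin n) → G, IsPlotAt q x ∧
      ∀ᶠ y in 𝓝 x, (QuotientGroup.mk (q y) : G ⧸ K) = p y :=
  exists_isPlotAt_lift QuotientGroup.mk_surjective hp x

theorem dSmooth_of_comp_mk {Y : Type*} [DiffeologicalSpace Y] {K : Subgroup G} {f : G ⧸ K → Y}
    (hf : DSmooth fun g : G => f (QuotientGroup.mk g)) : DSmooth f := by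
  refine dSmooth_of_isPlotAt fun n p hp x => ?_
  obtain ⟨q, hq, hqp⟩ := exists_isPlotAt_lift_coset hp x
  exact (hq.comp_dSmooth hf).congr (hqp.mono fun y hy => congrArg f hy)

variable [IsDiffeologicalGroup G]

theorem IsPlotAt.mul {p q : EuclideanSpace ℝ (Fin n) → G} {x : EuclideanSpace ℝ (Fin n)}
    (hp : IsPlotAt p x) (hq : IsPlotAt q x) : IsPlotAt (fun y => p y * q y) x :=
  (hp.prodMk hq).comp_dSmooth IsDiffeologicalGroup.dSmooth_mul

theorem IsPlotAt.inv {p : EuclideanSpace ℝ (Fin n) → G} {x : EuclideanSpace ℝ (Fin n)}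
    (hp : IsPlotAt p x) : IsPlotAt (fun y => (p y)⁻¹) x :=
  hp.comp_dSmooth IsDiffeologicalGroup.dSmooth_inv

theorem dSmooth_mul_left (g : G) : DSmooth fun a : G => g * a :=
  dSmooth_of_isPlotAt fun _ _ hp x => (isPlot_const.isPlotAt x).mul (hp.isPlotAt x)

theorem dSmooth_smul (K : Subgroup G) (g : G) : DSmooth fun b : G ⧸ K => g • b :=
  dSmooth_of_comp_mk ((dSmooth_mk K).comp (dSmooth_mul_left g))

end Cosets

/-- A map `F : G → X` from a compact group which identifies two elements exactly when they lie in
the same coset of `K`, and along which plots lift locally, induces a diffeomorphism `G ⧸ K → X`. -/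
theorem exists_diffeo_of_local_lifts {G X : Type*} [Group G] [TopologicalSpace G]
    [DiffeologicalSpace G] [CompactSpace G] [TopologicalSpace X] [T2Space X]
    [DiffeologicalSpace X] (K : Subgroup G) (F : G → X) (hcont : Continuous F) (hF : DSmooth F)
    (heq : ∀ a b, F a = F b ↔ a⁻¹ * b ∈ K)
    (hlift : ∀ (n : ℕ) (p : EuclideanSpace ℝ (Fin n) → X), IsPlot p → ∀ x,
      ∃ q : EuclideanSpace ℝ (Fin n) → G, IsPlotAt q x ∧ ∀ᶠ y in 𝓝 x, F (q y) = p y) :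
    ∃ Φ : Diffeo (G ⧸ K) X, ∀ g, Φ.toHomeomorph (QuotientGroup.mk g) = F g := by
  let f : G ⧸ K → X := Quotient.lift F fun a b h =>
    (heq a b).2 (QuotientGroup.leftRel_apply.1 h)
  have hf : Function.Bijective f := by
    constructor
    · intro a b
      induction a using QuotientGroup.induction_on with | _ a => ?_
      induction b using QuotientGroup.induction_on with | _ b => ?_
      exact fun h => QuotientGroup.eq.2 ((heq a b).1 h)
    · intro y
      obtain ⟨q, -, hq⟩ := hlift 0 (fun _ => y) isPlot_const 0
      exact ⟨QuotientGroup.mk (q 0), hq.self_of_nhds⟩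
  have hfc : Continuous f := continuous_quot_lift _ hcont
  let e : (G ⧸ K) ≃ₜ X :=
    Continuous.homeoOfEquivCompactToT2 (f := Equiv.ofBijective f hf) hfc
  refine ⟨⟨e, dSmooth_of_comp_mk hF, dSmooth_of_isPlotAt fun n p hp x => ?_⟩, fun g => rfl⟩
  obtain ⟨q, hq, hqp⟩ := hlift n p hp x
  refine (hq.comp_dSmooth (dSmooth_mk K)).congr (hqp.mono fun y hy => ?_)
  change _ = e.symm (p y)
  rw [← hy]
  exact (e.symm_apply_apply (QuotientGroup.mk (q y))).symm

/-! ### Homogeneous fibrations from local sections -/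

section LocalSection

variable {G : Type*} [Group G] [TopologicalSpace G] [DiffeologicalSpace G] {K L : Subgroup G}

/-- A local section of `G → G ⧸ L` on the open set `U`. The function is total and a set-theoretic
section everywhere; it is required to be continuous and smooth only on `U`. -/
structure LocalSection (L : Subgroup G) where
  /-- The section. -/
  toFun : G ⧸ L → G
  /-- The open set on which the section is smooth. -/
  U : Set (G ⧸ L)
  isOpen : IsOpen U
  mk_toFun : Function.RightInverse toFun QuotientGroup.mk
  continuousOn : ContinuousOn toFun U
  dSmoothOn : DSmoothOn toFun U

namespace LocalSection

theorem inv_mul_mem (σ : LocalSection L) (g : G) :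
    (σ.toFun (QuotientGroup.mk g))⁻¹ * g ∈ L :=
  QuotientGroup.eq.1 (σ.mk_toFun _)

/-- The element of `L` by which `g` moves the section `σ` at `b` to the section `σ'` at `g • b`. -/
theorem inv_mul_smul_mem (σ σ' : LocalSection L) (g : G) (b : G ⧸ L) :
    (σ'.toFun (g • b))⁻¹ * (g * σ.toFun b) ∈ L := by
  have : g • b = QuotientGroup.mk (g * σ.toFun b) := by
    change _ = g • (QuotientGroup.mk (σ.toFun b) : G ⧸ L)
    rw [σ.mk_toFun]
  rw [this]
  exact σ'.inv_mul_mem _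

variable [IsTopologicalGroup G] (hKL : K ≤ L) (σ : LocalSection L)

/-- The trivialization `gK ↦ (gL, σ(gL)⁻¹ g K)`, with inverse `(b, l K) ↦ σ(b) l K`. -/
def trivialization : Bundle.Trivialization (L ⧸ K.subgroupOf L)
    (Subgroup.quotientMapOfLE (α := G) hKL) where
  toPartialEquiv :=
    { toFun := Subgroup.quotientEquivProdOfLE' hKL σ.toFun σ.mk_toFun
      invFun := (Subgroup.quotientEquivProdOfLE' hKL σ.toFun σ.mk_toFun).symm
      source := Subgroup.quotientMapOfLE hKL ⁻¹' σ.U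
      target := σ.U ×ˢ Set.univ
      map_source' := fun x hx => by
        induction x using QuotientGroup.induction_on with | _ g => ?_
        exact ⟨hx, trivial⟩
      map_target' := fun x hx => by
        have h := (Subgroup.quotientEquivProdOfLE' hKL σ.toFun σ.mk_toFun).apply_symm_apply x
        revert h
        generalize (Subgroup.quotientEquivProdOfLE' hKL σ.toFun σ.mk_toFun).symm x = y
        rintro rfl
        induction y using QuotientGroup.induction_on with | _ g => ?_
        exact hx.1
      left_inv' := fun x _ => Equiv.symm_apply_apply _ x
      right_inv' := fun x _ => Equiv.apply_symm_apply _ x }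
  open_source := σ.isOpen.preimage (continuous_quot_lift _ QuotientGroup.continuous_mk)
  open_target := σ.isOpen.prod isOpen_univ
  continuousOn_toFun := by
    have hU : IsOpen (Subgroup.quotientMapOfLE hKL ⁻¹' σ.U) :=
      σ.isOpen.preimage (continuous_quot_lift _ QuotientGroup.continuous_mk)
    refine (QuotientGroup.isOpenQuotientMap_mk.isQuotientMap.continuousOn_isOpen_iff hU).2 ?_
    refine QuotientGroup.continuous_mk.continuousOn.prodMk ?_
    refine QuotientGroup.continuous_mk.comp_continuousOn
      (f := fun g : G => (⟨_, σ.inv_mul_mem g⟩ : L)) ?_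
    refine IsInducing.subtypeVal.continuousOn_iff.2 ?_
    exact (σ.continuousOn.comp QuotientGroup.continuous_mk.continuousOn fun _ hg => hg).inv.mul
      continuousOn_id
  continuousOn_invFun := by
    have hq : IsOpenQuotientMap
        (Prod.map id QuotientGroup.mk : (G ⧸ L) × L → (G ⧸ L) × (L ⧸ K.subgroupOf L)) :=
      IsOpenQuotientMap.id.prodMap QuotientGroup.isOpenQuotientMap_mk
    refine (hq.isQuotientMap.continuousOn_isOpen_iff (σ.isOpen.prod isOpen_univ)).2 ?_
    refine QuotientGroup.continuous_mk.comp_continuousOn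
      (f := fun x : (G ⧸ L) × L => σ.toFun x.1 * x.2) ?_
    exact (σ.continuousOn.comp continuousOn_fst fun _ hx => hx.1).mul
      (continuous_subtype_val.comp continuous_snd).continuousOn
  baseSet := σ.U
  open_baseSet := σ.isOpen
  source_eq := rfl
  target_eq := rfl
  proj_toFun := fun x _ => by
    induction x using QuotientGroup.induction_on with | _ g => ?_
    rfl

theorem trivialization_mk (g : G) : σ.trivialization hKL (QuotientGroup.mk g) =
    (QuotientGroup.mk g, QuotientGroup.mk ⟨_, σ.inv_mul_mem g⟩) :=
  rfl

theorem trivialization_symm_mk (b : G ⧸ L) (l : L) :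
    (σ.trivialization hKL).toOpenPartialHomeomorph.symm (b, QuotientGroup.mk l) =
      QuotientGroup.mk (σ.toFun b * l) :=
  rfl

variable [IsDiffeologicalGroup G]

/-- The translate of a local section by `h`. -/
def translate (σ : LocalSection L) (h : G) : LocalSection L where
  toFun b := h * σ.toFun (h⁻¹ • b)
  U := (fun b => h⁻¹ • b) ⁻¹' σ.U
  isOpen := σ.isOpen.preimage (continuous_const_smul h⁻¹)
  mk_toFun b := by
    change h • (QuotientGroup.mk (σ.toFun (h⁻¹ • b)) : G ⧸ L) = b
    rw [σ.mk_toFun, smul_inv_smul]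
  continuousOn := continuousOn_const.mul
    (σ.continuousOn.comp (continuous_const_smul h⁻¹).continuousOn fun _ hb => hb)
  dSmoothOn := dSmoothOn_of_isPlotAt fun _ _ hp hU x => (isPlot_const.isPlotAt x).mul <|
    ((hp.isPlotAt x).comp_dSmooth (dSmooth_smul L h⁻¹)).comp_dSmoothOn σ.dSmoothOn
      (.of_forall fun y => hU y)

theorem dSmoothOn_trivialization :
    DSmoothOn (σ.trivialization hKL) (σ.trivialization hKL).source := by
  refine dSmoothOn_of_isPlotAt fun n p hp hs x => ?_
  obtain ⟨q, hq, hqp⟩ := exists_isPlotAt_lift_coset hp x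
  have hU : ∀ᶠ y in 𝓝 x, (QuotientGroup.mk (q y) : G ⧸ L) ∈ σ.U := hqp.mono fun y hy => by
    have := hs y
    rw [← hy] at this
    exact this
  have hqL := hq.comp_dSmooth (dSmooth_mk L)
  have hl : IsPlotAt (fun y => (⟨_, σ.inv_mul_mem (q y)⟩ : L)) x :=
    (hqL.comp_dSmoothOn σ.dSmoothOn hU).inv.mul hq
  refine (hqL.prodMk (hl.comp_dSmooth (dSmooth_mk (K.subgroupOf L)))).congr
    (hqp.mono fun y hy => ?_)
  change _ = σ.trivialization hKL (p y)
  rw [← hy, trivialization_mk]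

theorem dSmoothOn_trivialization_symm :
    DSmoothOn (σ.trivialization hKL).toOpenPartialHomeomorph.symm
      (σ.trivialization hKL).target := by
  refine dSmoothOn_of_isPlotAt fun n p hp hs x => ?_
  obtain ⟨q, hq, hqp⟩ := exists_isPlotAt_lift_coset (dSmooth_snd _ _ hp) x
  have hσ : IsPlotAt (fun y => σ.toFun (p y).1) x :=
    ((hp.isPlotAt x).comp_dSmooth dSmooth_fst).comp_dSmoothOn σ.dSmoothOn (.of_forall fun y => (hs y).1)
  have hq' : IsPlotAt (fun y => (q y : G)) x := hq
  refine ((hσ.mul hq').comp_dSmooth (dSmooth_mk K)).congr (hqp.mono fun y hy => ?_)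
  change _ = (σ.trivialization hKL).toOpenPartialHomeomorph.symm (p y)
  have : p y = ((p y).1, QuotientGroup.mk (q y)) := Prod.ext (by rfl) hy.symm
  rw [this]
  rfl

/-- The translates of one smooth local section, defined near the base point, provide the atlas of
a homogeneous fibration. -/
theorem isHomogeneousFibration (σ : LocalSection L) (hσ : QuotientGroup.mk 1 ∈ σ.U)
    (hKL : K ≤ L) (hK : IsClosed (K : Set G)) (hL : IsClosed (L : Set G)) :
    IsHomogeneousFibration K L hKL where
  isClosed_left := hK
  isClosed_right := hL
  smooth := dSmooth_of_comp_mk (dSmooth_mk L)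
  equivariant g x := by
    induction x using QuotientGroup.induction_on with | _ a => ?_
    rfl
  exists_atlas := by
    refine ⟨Set.range fun h => (σ.translate h).trivialization hKL, fun b => ?_, ?_, ?_⟩
    · induction b using QuotientGroup.induction_on with | _ h => ?_
      refine ⟨_, ⟨h, rfl⟩, ?_⟩
      change (QuotientGroup.mk (h⁻¹ * h) : G ⧸ L) ∈ σ.U
      rwa [inv_mul_cancel]
    · rintro _ ⟨h, rfl⟩
      exact ⟨dSmoothOn_trivialization hKL _, dSmoothOn_trivialization_symm hKL _⟩
    · rintro _ ⟨h, rfl⟩ _ ⟨h', rfl⟩ g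
      refine ⟨fun b => ⟨_, inv_mul_smul_mem (σ.translate h) (σ.translate h') g b⟩, ?_, ?_⟩
      · refine dSmoothOn_of_isPlotAt fun n p hp hs x => ?_
        have h1 : IsPlotAt (fun y => (σ.translate h).toFun (p y)) x :=
          (hp.isPlotAt x).comp_dSmoothOn (σ.translate h).dSmoothOn (.of_forall fun y => (hs y).1)
        have h2 : IsPlotAt (fun y => (σ.translate h').toFun (g • p y)) x :=
          ((hp.isPlotAt x).comp_dSmooth (dSmooth_smul L g)).comp_dSmoothOn
            (σ.translate h').dSmoothOn (.of_forall fun y => (hs y).2)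
        exact h2.inv.mul ((isPlot_const.isPlotAt x).mul h1)
      · intro b _ _ x
        induction x using QuotientGroup.induction_on with | _ l => ?_
        have key : (QuotientGroup.mk (g * ((σ.translate h).toFun b * l)) : G ⧸ L) = g • b := by
          rw [← mul_assoc, QuotientGroup.mk_mul_of_mem _ l.2]
          change g • (QuotientGroup.mk ((σ.translate h).toFun b) : G ⧸ L) = g • b
          rw [(σ.translate h).mk_toFun]
        rw [trivialization_symm_mk]
        change (σ.translate h').trivialization hKL
          (QuotientGroup.mk (g * ((σ.translate h).toFun b * l))) = _
        rw [trivialization_mk]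
        refine Prod.ext key (congrArg QuotientGroup.mk (Subtype.ext ?_))
        simp only [key, mul_assoc, Subgroup.coe_mul, smul_eq_mul]

end LocalSection
end LocalSection

/-! ### Special unitary groups and projective spaces -/

section SpecialUnitary

variable {N : ℕ} {n : Type*} [Fintype n] [DecidableEq n]

instance : IsTopologicalGroup (Matrix.specialUnitaryGroup n ℂ) where
  continuous_mul := by
    refine continuous_induced_rng.2 ?_
    exact (continuous_subtype_val.comp continuous_fst).mul
      (continuous_subtype_val.comp continuous_snd)
  continuous_inv := continuous_induced_rng.2 continuous_subtype_val.star

instance : CompactSpace (Matrix.specialUnitaryGroup n ℂ) := by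
  refine isCompact_iff_compactSpace.1 ?_
  have hc : IsClosed (Matrix.specialUnitaryGroup n ℂ : Set (Matrix n n ℂ)) := by
    have : (Matrix.specialUnitaryGroup n ℂ : Set (Matrix n n ℂ)) =
        {A | A * star A = 1} ∩ {A | A.det = 1} := by
      ext A
      change A ∈ Matrix.specialUnitaryGroup n ℂ ↔ _
      rw [Matrix.mem_specialUnitaryGroup_iff, Matrix.mem_unitaryGroup_iff]
      rfl
    rw [this]
    exact (isClosed_eq (continuous_id.mul continuous_star) continuous_const).inter
      (isClosed_eq continuous_id.matrix_det continuous_const)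
  have hK : IsCompact (Set.univ.pi fun _ => Set.univ.pi fun _ => Metric.closedBall 0 1 :
      Set (Matrix n n ℂ)) :=
    isCompact_univ_pi fun _ => isCompact_univ_pi fun _ => isCompact_closedBall (0 : ℂ) 1
  refine hK.of_isClosed_subset hc fun A hA i _ j _ => ?_
  rw [mem_closedBall_zero_iff]
  exact entry_norm_bound_of_unitary hA.1 i j

/-- A map into a special unitary group is a plot where its matrix entries are smooth. -/
theorem isPlotAt_specialUnitary {p : EuclideanSpace ℝ (Fin N) → Matrix.specialUnitaryGroup n ℂ}
    {x : EuclideanSpace ℝ (Fin N)} :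
    IsPlotAt p x ↔ ∀ᶠ y in 𝓝 x, ∀ i j, ContDiffAt ℝ ∞ (fun z => (p z).1 i j) y := by
  have h : IsPlotAt p x ↔ @IsPlotAt _ _ (NormedSpace.toDiffeology (n → n → ℂ))
    (fun z i j => (p z).1 i j) x := Iff.rfl
  rw [h, isPlotAt_iff_contDiffAt]
  simp only [contDiffAt_pi]

instance : IsDiffeologicalGroup (Matrix.specialUnitaryGroup n ℂ) where
  dSmooth_mul := dSmooth_of_isPlotAt fun _ p hp x => by
    have h1 := isPlotAt_specialUnitary.1 ((hp.isPlotAt x).comp_dSmooth dSmooth_fst)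
    have h2 := isPlotAt_specialUnitary.1 ((hp.isPlotAt x).comp_dSmooth dSmooth_snd)
    refine isPlotAt_specialUnitary.2 ?_
    filter_upwards [h1, h2] with y h1 h2 i j
    exact ContDiffAt.sum fun k _ => (h1 i k).mul (h2 k j)
  dSmooth_inv := dSmooth_of_isPlotAt fun _ p hp x => by
    refine isPlotAt_specialUnitary.2 ?_
    filter_upwards [isPlotAt_specialUnitary.1 (hp.isPlotAt x)] with y h i j
    exact Complex.conjCLE.contDiff.contDiffAt.comp y (h j i)

instance {G : Type*} [Group G] [DiffeologicalSpace G] [IsDiffeologicalGroup G] (L : Subgroup G) :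
    IsDiffeologicalGroup L where
  dSmooth_mul := dSmooth_of_isPlotAt fun _ p hp x => by
    have h1 : IsPlotAt (fun y => ((p y).1 : G)) x := (hp.isPlotAt x).comp_dSmooth dSmooth_fst
    have h2 : IsPlotAt (fun y => ((p y).2 : G)) x := (hp.isPlotAt x).comp_dSmooth dSmooth_snd
    exact h1.mul h2
  dSmooth_inv := dSmooth_of_isPlotAt fun _ p hp x => by
    have h1 : IsPlotAt (fun y => (p y : G)) x := hp.isPlotAt x
    exact h1.inv

end SpecialUnitary

section ProjectiveSpace

variable {K ι : Type*} [RCLike K] [Fintype ι]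

open scoped ComplexOrder in
/-- Mapping a line to the matrix of the orthogonal projection onto it is a continuous injection of
projective space into a Hausdorff space. -/
instance : T2Space (ℙ K (ι → K)) := by
  let P : {v : ι → K // v ≠ 0} → ι → ι → K := fun v i j =>
    v.1 i * star (v.1 j) / ∑ k, v.1 k * star (v.1 k)
  have hpos : ∀ v : {v : ι → K // v ≠ 0}, ∑ k, v.1 k * star (v.1 k) ≠ 0 := fun v h =>
    v.2 (dotProduct_self_star_eq_zero.1 h)
  have hP : Continuous P := by
    have hc : ∀ i, Continuous fun v : {v : ι → K // v ≠ 0} => v.1 i := fun i =>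
      (continuous_apply i).comp continuous_subtype_val
    exact continuous_pi fun i => continuous_pi fun j => ((hc i).mul (hc j).star).div
      (continuous_finsetSum _ fun k _ => (hc k).mul (hc k).star) hpos
  have hPs : ∀ (a b : {v : ι → K // v ≠ 0}) (t : K), a.1 = t • b.1 → P a = P b := by
    intro a b t h
    have ht : t ≠ 0 := fun h0 => a.2 (by rw [h, h0, zero_smul])
    have ht' : star t ≠ 0 := star_ne_zero.2 ht
    funext i j
    have h1 : ∑ k, a.1 k * star (a.1 k) = (t * star t) * ∑ k, b.1 k * star (b.1 k) := by
      rw [h, Finset.mul_sum]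
      refine Finset.sum_congr rfl fun k _ => ?_
      simp only [Pi.smul_apply, smul_eq_mul, star_mul']
      ring
    have h2 : a.1 i * star (a.1 j) = (t * star t) * (b.1 i * star (b.1 j)) := by
      rw [h]
      simp only [Pi.smul_apply, smul_eq_mul, star_mul']
      ring
    change a.1 i * star (a.1 j) / _ = b.1 i * star (b.1 j) / _
    rw [h1, h2, mul_div_mul_left _ _ (mul_ne_zero ht ht')]
  have hPi : ∀ a b : {v : ι → K // v ≠ 0}, P a = P b → ∃ t : K, t • b.1 = a.1 := by
    intro a b h
    obtain ⟨j, hj⟩ := Function.ne_iff.1 a.2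
    have hj' : star (a.1 j) ≠ 0 := star_ne_zero.2 hj
    refine ⟨star (b.1 j) / (∑ k, b.1 k * star (b.1 k)) *
      (∑ k, a.1 k * star (a.1 k)) / star (a.1 j), funext fun i => ?_⟩
    have h1 : a.1 i * star (a.1 j) / _ = b.1 i * star (b.1 j) / _ := congrFun (congrFun h i) j
    have ha := hpos a
    have hb := hpos b
    simp only [Pi.smul_apply, smul_eq_mul]
    generalize ∑ k, a.1 k * star (a.1 k) = s at *
    generalize ∑ k, b.1 k * star (b.1 k) = r at *
    field_simp at h1 ⊢
    linear_combination -h1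
  refine T2Space.of_injective_continuous (f := Projectivization.lift P hPs) ?_
    (continuous_quot_lift _ hP)
  intro a b
  induction a with | _ v hv => ?_
  induction b with | _ w hw => ?_
  exact fun h => (Projectivization.mk_eq_mk_iff' K v w hv hw).2 (hPi ⟨v, hv⟩ ⟨w, hw⟩ h)

theorem continuous_projectivization_mk' : Continuous (Projectivization.mk' K (V := ι → K)) :=
  continuous_coinduced_rng

end ProjectiveSpace

section ProjectivePlots

variable {K V : Type*} [Field K] [NormedAddCommGroup V] [Module K V] [NormedSpace ℝ V]
  [FiniteDimensional ℝ V] {n : ℕ}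

/-- A map into projective space is a plot where it is represented by a smooth nonvanishing map. -/
theorem isPlotAt_projectivization {p : EuclideanSpace ℝ (Fin n) → {v : V // v ≠ 0}}
    {x : EuclideanSpace ℝ (Fin n)} (hp : ∀ᶠ y in 𝓝 x, ContDiffAt ℝ ∞ (fun z => (p z).1) y) :
    IsPlotAt (fun y => Projectivization.mk' K (p y)) x := by
  let _ : DiffeologicalSpace {v : V // v ≠ 0} :=
    inducedDiffeology (NormedSpace.toDiffeology V) Subtype.val
  have h : IsPlotAt p x := isPlotAt_iff_contDiffAt.2 hp
  exact h.comp_dSmooth (dSmooth_coinduced _ _)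

theorem exists_lift_projectivization {p : EuclideanSpace ℝ (Fin n) → ℙ K V} (hp : IsPlot p)
    (x : EuclideanSpace ℝ (Fin n)) :
    ∃ q : EuclideanSpace ℝ (Fin n) → {v : V // v ≠ 0},
      (∀ᶠ y in 𝓝 x, ContDiffAt ℝ ∞ (fun z => (q z).1) y) ∧
      ∀ᶠ y in 𝓝 x, Projectivization.mk' K (q y) = p y := by
  obtain ⟨q, hq, hqp⟩ := exists_isPlotAt_lift Quotient.mk''_surjective hp x
  exact ⟨q, isPlotAt_iff_contDiffAt.1 hq, hqp⟩

end ProjectivePlots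

/-! ### Special unitary matrices with a prescribed column -/

section Column

theorem contDiffAt_matrix_mul {E l m n : Type*} [Fintype n] [NormedAddCommGroup E] [NormedSpace ℝ E]
    {A : E → Matrix l n ℂ} {B : E → Matrix n m ℂ} {x : E}
    (hA : ∀ i j, ContDiffAt ℝ ∞ (fun y => A y i j) x)
    (hB : ∀ i j, ContDiffAt ℝ ∞ (fun y => B y i j) x) (i : l) (j : m) :
    ContDiffAt ℝ ∞ (fun y => (A y * B y) i j) x := by
  simp only [Matrix.mul_apply]
  exact ContDiffAt.sum fun k _ => (hA i k).mul (hB k j)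

variable {n : Type*} [DecidableEq n]

theorem contDiffAt_star {E : Type*} [NormedAddCommGroup E] [NormedSpace ℝ E] {f : E → ℂ} {x : E}
    (h : ContDiffAt ℝ ∞ f x) : ContDiffAt ℝ ∞ (fun y => star (f y)) x :=
  Complex.conjCLE.contDiff.contDiffAt.comp x h

/-- For a unit vector `u` this is, up to sign, the complex reflection along `w = e + u` which maps
the basis vector `e` to `-u`. It is smooth in `u` as long as `u` is not `-e`. -/
def reflectionMatrix (e : n) (u : n → ℂ) : Matrix n n ℂ :=
  (star ((Pi.single e 1 + u : n → ℂ) e))⁻¹ •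
    Matrix.vecMulVec (Pi.single e 1 + u) (star (Pi.single e 1 + u)) - 1

variable {e f : n} {u : n → ℂ}

theorem reflectionMatrix_apply (i j : n) : reflectionMatrix e u i j =
    (star ((Pi.single e 1 + u : n → ℂ) e))⁻¹ * ((Pi.single e 1 + u : n → ℂ) i *
      star ((Pi.single e 1 + u : n → ℂ) j)) - (1 : Matrix n n ℂ) i j :=
  rfl

theorem reflectionMatrix_col (hu : 1 + u e ≠ 0) (i : n) : reflectionMatrix e u i e = u i := by
  have h1 : (Pi.single e 1 + u : n → ℂ) e ≠ 0 := by simpa using hu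
  have h2 : star ((Pi.single e 1 + u : n → ℂ) e) ≠ 0 := star_ne_zero.2 h1
  rw [reflectionMatrix_apply, mul_comm, mul_assoc, mul_inv_cancel₀ h2, Pi.add_apply,
    Matrix.one_apply, Pi.single_apply]
  ring

variable [Fintype n]

theorem contDiffAt_det {E : Type*} [NormedAddCommGroup E] [NormedSpace ℝ E] {A : E → Matrix n n ℂ}
    {x : E} (h : ∀ i j, ContDiffAt ℝ ∞ (fun y => A y i j) x) :
    ContDiffAt ℝ ∞ (fun y => (A y).det) x := by
  simp only [Matrix.det_apply]
  exact ContDiffAt.sum fun σ _ => (contDiffAt_prod fun i _ => h _ i).const_smul _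

/-- The reflection matrix, with determinant normalized to `1` by rescaling column `f`; for `f ≠ e`
this leaves the column `e`, which is `u`, unchanged. -/
def columnMatrix (e f : n) (u : n → ℂ) : Matrix n n ℂ :=
  reflectionMatrix e u *
    Matrix.diagonal (Function.update 1 f (star (reflectionMatrix e u).det))

theorem reflectionMatrix_mem_unitaryGroup (hu : 1 + u e ≠ 0) (hn : star u ⬝ᵥ u = 1) :
    reflectionMatrix e u ∈ Matrix.unitaryGroup n ℂ := by
  have hw : star (Pi.single e 1 + u : n → ℂ) ⬝ᵥ (Pi.single e 1 + u) =
      (1 + u e) + star (1 + u e) := by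
    have h1 : star (Pi.single e 1 : n → ℂ) = Pi.single e 1 := by
      rw [← Pi.single_star, star_one]
    rw [star_add, add_dotProduct, dotProduct_add, dotProduct_add, hn, h1]
    simp
    ring
  have hwe : (Pi.single e 1 + u : n → ℂ) e = 1 + u e := by simp
  rw [Matrix.mem_unitaryGroup_iff]
  unfold reflectionMatrix
  rw [hwe]
  generalize (Pi.single e 1 + u : n → ℂ) = w at *
  generalize 1 + u e = c at *
  have hc : star c ≠ 0 := star_ne_zero.2 hu
  have h1 : (Matrix.vecMulVec w (star w))ᴴ = Matrix.vecMulVec w (star w) := by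
    rw [Matrix.conjTranspose_vecMulVec, star_star]
  have h2 : Matrix.vecMulVec w (star w) * Matrix.vecMulVec w (star w) =
      (c + star c) • Matrix.vecMulVec w (star w) := by
    rw [Matrix.vecMulVec_mul_vecMulVec, hw, Matrix.vecMulVec_smul]
  rw [star_sub, star_one, Matrix.star_eq_conjTranspose, Matrix.conjTranspose_smul, h1, sub_mul,
    mul_sub, smul_mul_smul_comm, h2]
  simp only [mul_one, one_mul, star_inv₀, star_star, smul_smul]
  have h3 : (star c)⁻¹ * c⁻¹ * (c + star c) = (star c)⁻¹ + c⁻¹ := by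
    field_simp
  rw [h3, add_smul]
  abel

theorem columnMatrix_col (hef : e ≠ f) (hu : 1 + u e ≠ 0) (i : n) :
    columnMatrix e f u i e = u i := by
  rw [columnMatrix, Matrix.mul_diagonal, Function.update_of_ne hef, Pi.one_apply, mul_one,
    reflectionMatrix_col hu]

theorem columnMatrix_mem (hu : 1 + u e ≠ 0) (hn : star u ⬝ᵥ u = 1) :
    columnMatrix e f u ∈ Matrix.specialUnitaryGroup n ℂ := by
  have h := reflectionMatrix_mem_unitaryGroup hu hn
  have hd := Matrix.det_of_mem_unitary h
  have hprod : ∀ c : ℂ, ∏ i, Function.update (1 : n → ℂ) f c i = c := fun c => by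
    rw [Finset.prod_update_of_mem (Finset.mem_univ f)]
    simp
  refine Matrix.mem_specialUnitaryGroup_iff.2 ⟨mul_mem h ?_, ?_⟩
  · rw [Matrix.mem_unitaryGroup_iff, Matrix.star_eq_conjTranspose, Matrix.diagonal_conjTranspose,
      Matrix.diagonal_mul_diagonal, ← Matrix.diagonal_one]
    congr 1
    funext i
    rw [Pi.star_apply]
    by_cases hi : i = f
    · subst hi
      rw [Function.update_self, star_star]
      exact hd.1
    · rw [Function.update_of_ne hi]
      simp
  · rw [columnMatrix, Matrix.det_mul, Matrix.det_diagonal, hprod]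
    exact hd.2

theorem contDiffAt_reflectionMatrix (hu : 1 + u e ≠ 0) (i j : n) :
    ContDiffAt ℝ ∞ (fun v => reflectionMatrix e v i j) u := by
  have h : ∀ k, ContDiffAt ℝ ∞ (fun v : n → ℂ => (Pi.single e 1 + v : n → ℂ) k) u := fun k =>
    contDiffAt_const.add (contDiff_apply ℝ ℂ k).contDiffAt
  simp only [reflectionMatrix_apply]
  refine ((ContDiffAt.inv (contDiffAt_star (h e)) ?_).mul ((h i).mul
    (contDiffAt_star (h j)))).sub contDiffAt_const
  simpa using star_ne_zero.2 hu

theorem contDiffAt_columnMatrix (hu : 1 + u e ≠ 0) (i j : n) :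
    ContDiffAt ℝ ∞ (fun v => columnMatrix e f v i j) u := by
  simp only [columnMatrix, Matrix.mul_diagonal]
  refine (contDiffAt_reflectionMatrix hu i j).mul ?_
  by_cases hj : j = f
  · subst hj
    simp only [Function.update_self]
    exact contDiffAt_star (contDiffAt_det (contDiffAt_reflectionMatrix hu))
  · simp only [Function.update_of_ne hj]
    exact contDiffAt_const

theorem col_dotProduct (g : Matrix.specialUnitaryGroup n ℂ) (e : n) :
    (star fun i => g.1 i e) ⬝ᵥ (fun i => g.1 i e) = 1 := by
  have h : (star g.1 * g.1) e e = 1 := by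
    rw [g.2.1.1, Matrix.one_apply_eq]
  exact h

theorem col_ne_zero (g : Matrix.specialUnitaryGroup n ℂ) (e : n) : (fun i => g.1 i e) ≠ 0 := by
  intro h
  have := col_dotProduct g e
  rw [h, dotProduct_zero] at this
  exact zero_ne_one this

end Column

/-! ### The base as a complex projective space -/

section Base

/-- The index of the last coordinate of `ℂ⁵`. -/
abbrev last : (Fin 2 ⊕ Fin 2) ⊕ Unit := Sum.inr ()

/-- The first index of `ℂ⁵`, used for normalizing determinants. -/
abbrev first : (Fin 2 ⊕ Fin 2) ⊕ Unit := Sum.inl (Sum.inl 0)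

theorem last_ne_first : last ≠ first := Sum.inr_ne_inl

open scoped Classical in
/-- The special unitary matrix with last column a given unit vector other than `-e₅`; the value at
other vectors is irrelevant. -/
def ofColumn (u : (Fin 2 ⊕ Fin 2) ⊕ Unit → ℂ) : SU5 :=
  if h : columnMatrix last first u ∈ Matrix.specialUnitaryGroup _ ℂ then ⟨_, h⟩ else 1

theorem coe_ofColumn {u : (Fin 2 ⊕ Fin 2) ⊕ Unit → ℂ} (hu : 1 + u last ≠ 0)
    (hn : star u ⬝ᵥ u = 1) : (ofColumn u).1 = columnMatrix last first u := by
  rw [ofColumn, dif_pos (columnMatrix_mem hu hn)]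

/-- For a unitary matrix the vanishing of one off-diagonal block forces that of the other. -/
theorem mem_SU4U1_iff {g : SU5} : g ∈ SU4U1 ↔ ∀ i, g.1 (Sum.inl i) last = 0 := by
  constructor
  · rintro ⟨A, hA, d, hd, h⟩ i
    rw [h]
    rfl
  · intro h
    have hb : g.1 = Matrix.fromBlocks g.1.toBlocks₁₁ 0 g.1.toBlocks₂₁ g.1.toBlocks₂₂ := by
      conv_lhs => rw [← Matrix.fromBlocks_toBlocks g.1]
      congr 1
      ext i j
      exact h i
    have hg : star g.1 * g.1 = 1 := g.2.1.1
    rw [hb, Matrix.star_eq_conjTranspose, Matrix.fromBlocks_conjTranspose,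
      Matrix.fromBlocks_multiply, ← Matrix.fromBlocks_one, Matrix.fromBlocks_inj] at hg
    simp only [Matrix.conjTranspose_zero, Matrix.mul_zero, Matrix.zero_mul, zero_add] at hg
    obtain ⟨h11, h12, -, h22⟩ := hg
    -- The last diagonal entry is invertible, so the row beside it vanishes.
    have h0 : g.1.toBlocks₂₁ = 0 := by
      have h3 : g.1.toBlocks₂₁ᴴ * g.1.toBlocks₂₂ * g.1.toBlocks₂₂ᴴ = 0 := by
        rw [h12, Matrix.zero_mul]
      rw [Matrix.mul_assoc, mul_eq_one_comm.1 h22, Matrix.mul_one] at h3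
      exact Matrix.conjTranspose_eq_zero.1 h3
    rw [h0, Matrix.conjTranspose_zero, Matrix.zero_mul, add_zero] at h11
    refine ⟨_, ?_, _, ?_, h0 ▸ hb⟩
    · exact Matrix.mem_unitaryGroup_iff'.2 h11
    · exact Matrix.mem_unitaryGroup_iff'.2 h22

theorem isClosed_SU4U1 : IsClosed (SU4U1 : Set SU5) := by
  have : (SU4U1 : Set SU5) = ⋂ i, {g : SU5 | g.1 (Sum.inl i) last = 0} := by
    ext g
    simp only [SetLike.mem_coe, mem_SU4U1_iff, Set.mem_iInter, Set.mem_ofPred_eq]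
  rw [this]
  exact isClosed_iInter fun i =>
    isClosed_eq (continuous_subtype_val.matrix_elem _ _) continuous_const

theorem col_eq_mulVec (g : SU5) : (fun i => g.1 i last) = g.1 *ᵥ Pi.single last 1 := by
  rw [Matrix.mulVec_single_one]
  rfl

/-- The cosets of `S(U(4) × U(1))` are the lines spanned by the last columns. -/
theorem inv_mul_mem_SU4U1_iff (a b : SU5) :
    a⁻¹ * b ∈ SU4U1 ↔ ∃ t : ℂ, (t • fun i => b.1 i last) = fun i => a.1 i last := by
  have hinv : a.1 * (a⁻¹).1 = 1 := a.2.1.2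
  have hinv' : (a⁻¹).1 * a.1 = 1 := a.2.1.1
  have hc : (fun i => (a⁻¹ * b).1 i last) = (a⁻¹).1 *ᵥ fun i => b.1 i last := by
    rw [col_eq_mulVec, col_eq_mulVec, Matrix.mulVec_mulVec]
    rfl
  rw [mem_SU4U1_iff]
  constructor
  · intro h
    have h1 : (fun i => (a⁻¹ * b).1 i last) =
        (a⁻¹ * b).1 last last • (Pi.single last 1 : _ → ℂ) := by
      funext i
      rcases i with i | i
      · simp [h i]
      · simp
    have h2 : (a⁻¹ * b).1 last last ≠ 0 := fun h0 =>
      col_ne_zero (a⁻¹ * b) last (by rw [h1, h0, zero_smul])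
    refine ⟨((a⁻¹ * b).1 last last)⁻¹, ?_⟩
    have h3 : (fun i => b.1 i last) = a.1 *ᵥ ((a⁻¹).1 *ᵥ fun i => b.1 i last) := by
      rw [Matrix.mulVec_mulVec, hinv, Matrix.one_mulVec]
    rw [h3, ← hc, h1, Matrix.mulVec_smul, smul_smul, inv_mul_cancel₀ h2, one_smul, col_eq_mulVec]
  · rintro ⟨t, ht⟩ i
    have ht0 : t ≠ 0 := fun h0 => col_ne_zero a last (by rw [← ht, h0, zero_smul])
    have h1 : t • (fun i => (a⁻¹ * b).1 i last) = Pi.single last 1 := by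
      rw [hc, ← Matrix.mulVec_smul, ht, col_eq_mulVec, Matrix.mulVec_mulVec, hinv',
        Matrix.one_mulVec]
    have h2 := congrFun h1 (Sum.inl i)
    simp only [Pi.smul_apply, smul_eq_mul] at h2
    rw [Pi.single_eq_of_ne (by simp)] at h2
    exact (mul_eq_zero.1 h2).resolve_left ht0

variable {N : ℕ}

/-- A smooth family of unit vectors avoiding `-e₅` is the last column of a smooth family in
`SU(5)`. -/
theorem exists_isPlotAt_col {u : EuclideanSpace ℝ (Fin N) → (Fin 2 ⊕ Fin 2) ⊕ Unit → ℂ}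
    {x : EuclideanSpace ℝ (Fin N)} (hu : ∀ᶠ y in 𝓝 x, ContDiffAt ℝ ∞ u y)
    (hn : ∀ᶠ y in 𝓝 x, star (u y) ⬝ᵥ u y = 1) (he : 1 + u x last ≠ 0) :
    ∃ q : EuclideanSpace ℝ (Fin N) → SU5, IsPlotAt q x ∧
      ∀ᶠ y in 𝓝 x, (fun i => (q y).1 i last) = u y := by
  have hc : ContinuousAt (fun y => 1 + u y last) x :=
    continuousAt_const.add (continuousAt_pi.1 hu.self_of_nhds.continuousAt last)
  have he' := hc.eventually_ne he
  have hq : ∀ᶠ y in 𝓝 x, (ofColumn (u y)).1 = columnMatrix last first (u y) := by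
    filter_upwards [hn, he'] with y hn he using coe_ofColumn he hn
  refine ⟨fun y => ofColumn (u y), isPlotAt_specialUnitary.2 ?_, ?_⟩
  · filter_upwards [hq.eventually_nhds, hu, he'] with y hq hu he i j
    refine ContDiffAt.congr_of_eventuallyEq
      ((contDiffAt_columnMatrix (f := first) he i j).comp y hu) ?_
    filter_upwards [hq] with z hz
    rw [hz]
    rfl
  · filter_upwards [hq, he'] with y hq he
    funext i
    rw [hq, columnMatrix_col last_ne_first he]

theorem exists_diffeo_base :
    ∃ Φ : Diffeo (SU5 ⧸ SU4U1) (ℙ ℂ ((Fin 2 ⊕ Fin 2) ⊕ Unit → ℂ)),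
      ∀ g : SU5, ∃ hg : (fun i => g.1 i (Sum.inr ())) ≠ 0,
        Φ.toHomeomorph (QuotientGroup.mk g) =
          Projectivization.mk ℂ (fun i => g.1 i (Sum.inr ())) hg := by
  let c : SU5 → {v : (Fin 2 ⊕ Fin 2) ⊕ Unit → ℂ // v ≠ 0} := fun g =>
    ⟨fun i => g.1 i last, col_ne_zero g last⟩
  refine (exists_diffeo_of_local_lifts SU4U1 (fun g => Projectivization.mk' ℂ (c g))
    ?_ ?_ ?_ ?_).imp fun Φ hΦ g => ⟨col_ne_zero g last, hΦ g⟩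
  · refine continuous_projectivization_mk'.comp (continuous_induced_rng.2 ?_)
    exact continuous_pi fun i => continuous_subtype_val.matrix_elem _ _
  · refine dSmooth_of_isPlotAt fun n p hp x => isPlotAt_projectivization ?_
    filter_upwards [isPlotAt_specialUnitary.1 (hp.isPlotAt x)] with y hy
    exact contDiffAt_pi.2 fun i => hy i last
  · intro a b
    rw [inv_mul_mem_SU4U1_iff]
    exact Projectivization.mk_eq_mk_iff' ℂ _ _ (c a).2 (c b).2
  · intro n p hp x
    obtain ⟨v, hv, hvp⟩ := exists_lift_projectivization hp x
    let r : EuclideanSpace ℝ (Fin n) → ℝ := fun y => ∑ k, Complex.normSq ((v y).1 k)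
    have hr0 : ∀ y, 0 < r y := fun y => by
      obtain ⟨j, hj⟩ := Function.ne_iff.1 (v y).2
      exact Finset.sum_pos' (fun k _ => Complex.normSq_nonneg _)
        ⟨j, Finset.mem_univ j, Complex.normSq_pos.2 hj⟩
    have hrs : ∀ y, star (v y).1 ⬝ᵥ (v y).1 = (r y : ℂ) := fun y => by
      simp only [dotProduct, r, Complex.ofReal_sum, Complex.normSq_eq_conj_mul_self]
      rfl
    have hsq : ∀ y, (Real.sqrt (r y) : ℂ)⁻¹ * (Real.sqrt (r y) : ℂ)⁻¹ * r y = 1 := fun y => by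
      have h1 : ((Real.sqrt (r y) : ℝ) : ℂ) * (Real.sqrt (r y) : ℝ) = r y := by
        rw [← Complex.ofReal_mul, Real.mul_self_sqrt (hr0 y).le]
      have h2 : ((Real.sqrt (r y) : ℝ) : ℂ) ≠ 0 :=
        Complex.ofReal_ne_zero.2 (Real.sqrt_pos.2 (hr0 y)).ne'
      rw [← h1]
      field_simp
    -- Of the two unit vectors `±v / |v|` at least one is not `-e₅`.
    obtain ⟨ε, hε, hεx⟩ : ∃ ε : ℝ, ε * ε = 1 ∧
        1 + (((ε : ℂ) * (Real.sqrt (r x) : ℂ)⁻¹) • (v x).1) last ≠ 0 := by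
      by_cases h : 1 + (((1 : ℝ) : ℂ) * (Real.sqrt (r x) : ℂ)⁻¹) * (v x).1 last = 0
      · refine ⟨-1, by norm_num, fun h' => ?_⟩
        simp only [Pi.smul_apply, smul_eq_mul] at h'
        have h2 : (2 : ℂ) = 0 := by
          push_cast at h h'
          linear_combination h + h'
        exact two_ne_zero h2
      · exact ⟨1, by norm_num, h⟩
    have hε' : (ε : ℂ) * ε = 1 := by exact_mod_cast hε
    have hu1 : ∀ᶠ y in 𝓝 x,
        ContDiffAt ℝ ∞ (fun z => ((ε : ℂ) * (Real.sqrt (r z) : ℂ)⁻¹) • (v z).1) y := by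
      filter_upwards [hv] with y hv
      have hk := contDiffAt_pi.1 hv
      have h1 : ContDiffAt ℝ ∞ r y := ContDiffAt.sum fun k _ => by
        have h2 : (fun z => Complex.normSq ((v z).1 k)) = fun z => ‖(v z).1 k‖ ^ 2 :=
          funext fun z => Complex.normSq_eq_norm_sq _
        rw [h2]
        exact (hk k).norm_sq ℝ
      have h3 : ContDiffAt ℝ ∞ (fun z => ((Real.sqrt (r z) : ℝ) : ℂ)) y :=
        Complex.ofRealCLM.contDiff.contDiffAt.comp y (h1.sqrt (hr0 y).ne')
      have h4 := h3.inv (Complex.ofReal_ne_zero.2 (Real.sqrt_pos.2 (hr0 y)).ne')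
      exact contDiffAt_pi.2 fun k => (contDiffAt_const.mul h4).mul (hk k)
    have hu2 : ∀ᶠ y in 𝓝 x, star (((ε : ℂ) * (Real.sqrt (r y) : ℂ)⁻¹) • (v y).1) ⬝ᵥ
        (((ε : ℂ) * (Real.sqrt (r y) : ℂ)⁻¹) • (v y).1) = 1 := by
      refine .of_forall fun y => ?_
      simp only [star_smul, smul_dotProduct, dotProduct_smul, hrs, smul_eq_mul]
      have h5 : star ((ε : ℂ) * (Real.sqrt (r y) : ℂ)⁻¹) = (ε : ℂ) * (Real.sqrt (r y) : ℂ)⁻¹ := by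
        simp
      rw [h5]
      linear_combination
        ((Real.sqrt (r y) : ℂ)⁻¹ * (Real.sqrt (r y) : ℂ)⁻¹ * r y) * hε' + hsq y
    obtain ⟨q, hq, hqu⟩ := exists_isPlotAt_col hu1 hu2 hεx
    refine ⟨q, hq, ?_⟩
    filter_upwards [hqu, hvp] with y hy hvp
    rw [← hvp]
    exact (Projectivization.mk_eq_mk_iff' ℂ _ _ (c (q y)).2 (v y).2).2 ⟨_, hy.symm⟩

theorem mul_star_mul_inv_norm {z : ℂ} (hz : z ≠ 0) : star z * (‖z‖ : ℂ)⁻¹ * z = ‖z‖ := by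
  have h0 : (‖z‖ : ℂ) ≠ 0 := Complex.ofReal_ne_zero.2 (norm_ne_zero_iff.2 hz)
  have h1 : star z * z = (‖z‖ : ℂ) ^ 2 := Complex.conj_mul' z
  field_simp
  linear_combination h1

/-- The vector `v`, multiplied by the phase which makes its last coordinate nonnegative. -/
def rotate (v : (Fin 2 ⊕ Fin 2) ⊕ Unit → ℂ) : (Fin 2 ⊕ Fin 2) ⊕ Unit → ℂ :=
  (star (v last) * (‖v last‖ : ℂ)⁻¹) • v

variable {v : (Fin 2 ⊕ Fin 2) ⊕ Unit → ℂ}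

theorem rotate_dotProduct (hv : v last ≠ 0) : star (rotate v) ⬝ᵥ rotate v = star v ⬝ᵥ v := by
  have h0 : (‖v last‖ : ℂ) ≠ 0 := Complex.ofReal_ne_zero.2 (norm_ne_zero_iff.2 hv)
  have h1 : star (‖v last‖ : ℂ) = ‖v last‖ := Complex.conj_ofReal _
  have h2 : star (v last) * v last = (‖v last‖ : ℂ) ^ 2 := Complex.conj_mul' _
  simp only [rotate, star_smul, smul_dotProduct, dotProduct_smul, smul_eq_mul, star_mul',
    star_star, star_inv₀, h1]
  field_simp
  linear_combination (star v ⬝ᵥ v) * h2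

theorem one_add_rotate_ne_zero (hv : v last ≠ 0) : 1 + rotate v last ≠ 0 := fun h => by
  have h1 : rotate v last = ‖v last‖ := mul_star_mul_inv_norm hv
  rw [h1] at h
  have h2 : (1 : ℝ) + ‖v last‖ = 0 := by exact_mod_cast h
  have h3 := norm_nonneg (v last)
  linarith

theorem rotate_mul {t : ℂ} (ht : ‖t‖ = 1) : rotate (fun i => v i * t) = rotate v := by
  have h3 : t * star t = 1 := by
    have := Complex.mul_conj' t
    rw [ht] at this
    simpa using this
  funext i
  simp only [rotate, Pi.smul_apply, smul_eq_mul, norm_mul, ht, mul_one, star_mul']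
  linear_combination (star (v last) * (‖v last‖ : ℂ)⁻¹ * v i) * h3

theorem contDiffAt_rotate (hv : v last ≠ 0) : ContDiffAt ℝ ∞ rotate v := by
  have h1 : ∀ k, ContDiffAt ℝ ∞ (fun v : (Fin 2 ⊕ Fin 2) ⊕ Unit → ℂ => v k) v := fun k =>
    (contDiff_apply ℝ ℂ k).contDiffAt
  have h2 : ContDiffAt ℝ ∞ (fun v : (Fin 2 ⊕ Fin 2) ⊕ Unit → ℂ => (‖v last‖ : ℂ)⁻¹) v :=
    (Complex.ofRealCLM.contDiff.contDiffAt.comp v ((h1 last).norm ℝ hv)).inv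
      (Complex.ofReal_ne_zero.2 (norm_ne_zero_iff.2 hv))
  exact contDiffAt_pi.2 fun k => ((contDiffAt_star (h1 last)).mul h2).mul (h1 k)

theorem contDiffAt_columnMatrix_rotate (hv : v last ≠ 0) (i j : (Fin 2 ⊕ Fin 2) ⊕ Unit) :
    ContDiffAt ℝ ∞ (fun w => columnMatrix last first (rotate w) i j) v :=
  ContDiffAt.comp (g := fun w => columnMatrix last first w i j) (f := rotate) v
    (contDiffAt_columnMatrix (one_add_rotate_ne_zero hv) i j) (contDiffAt_rotate hv)

/-- For `g₅₅ ≠ 0`, an element of `g S(U(4) × U(1))` which depends only on this coset. -/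
def sectionLift (g : SU5) : SU5 :=
  ofColumn (rotate fun i => g.1 i last)

theorem coe_sectionLift {g : SU5} (hg : g.1 last last ≠ 0) :
    (sectionLift g).1 = columnMatrix last first (rotate fun i => g.1 i last) :=
  coe_ofColumn (one_add_rotate_ne_zero (v := fun i => g.1 i last) hg)
    ((rotate_dotProduct (v := fun i => g.1 i last) hg).trans (col_dotProduct g last))

theorem norm_last_of_mem {l : SU5} (hl : l ∈ SU4U1) : ‖l.1 last last‖ = 1 := by
  have h := col_dotProduct l last
  simp only [dotProduct, Fintype.sum_sum_type (α₁ := Fin 2 ⊕ Fin 2), mem_SU4U1_iff.1 hl,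
    mul_zero, Finset.sum_const_zero, zero_add, Finset.univ_unique, Finset.sum_singleton] at h
  have h1 : ‖l.1 last last‖ ^ 2 = 1 := by
    have h2 := (Complex.conj_mul' (l.1 last last)).symm.trans h
    exact_mod_cast h2
  exact (pow_eq_one_iff_of_nonneg (norm_nonneg _) two_ne_zero).1 h1

theorem mul_last_of_mem (g : SU5) {l : SU5} (hl : l ∈ SU4U1) (i : (Fin 2 ⊕ Fin 2) ⊕ Unit) :
    (g * l).1 i last = g.1 i last * l.1 last last := by
  change ∑ k, g.1 i k * l.1 k last = _
  rw [Fintype.sum_sum_type]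
  simp [mem_SU4U1_iff.1 hl]

theorem sectionLift_mul (g : SU5) {l : SU5} (hl : l ∈ SU4U1) :
    sectionLift (g * l) = sectionLift g := by
  have h : (rotate fun i => (g * l).1 i last) = rotate fun i => g.1 i last := by
    rw [funext (mul_last_of_mem g hl)]
    exact rotate_mul (norm_last_of_mem hl)
  rw [sectionLift, h, sectionLift]

theorem mk_sectionLift {g : SU5} (hg : g.1 last last ≠ 0) :
    (QuotientGroup.mk (sectionLift g) : SU5 ⧸ SU4U1) = QuotientGroup.mk g := by
  refine QuotientGroup.eq.2 ((inv_mul_mem_SU4U1_iff _ _).2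
    ⟨star (g.1 last last) * (‖g.1 last last‖ : ℂ)⁻¹, ?_⟩)
  rw [coe_sectionLift hg]
  funext i
  rw [columnMatrix_col last_ne_first (one_add_rotate_ne_zero (v := fun i => g.1 i last) hg)]
  rfl

theorem continuousOn_sectionLift : ContinuousOn sectionLift {g | g.1 last last ≠ 0} := by
  refine IsInducing.subtypeVal.continuousOn_iff.2 fun g hg => ?_
  have h1 : ContinuousAt (fun g : SU5 => columnMatrix last first (rotate fun i => g.1 i last)) g :=
    continuousAt_pi.2 fun i => continuousAt_pi.2 fun j =>
      ContinuousAt.comp (f := fun g : SU5 => fun i => g.1 i last)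
        (contDiffAt_columnMatrix_rotate (v := fun i => g.1 i last) hg i j).continuousAt
        (continuous_pi fun i => continuous_subtype_val.matrix_elem _ _).continuousAt
  exact (h1.continuousWithinAt (s := _)).congr (fun a ha => coe_sectionLift ha)
    (coe_sectionLift hg)

theorem isPlotAt_sectionLift {q : EuclideanSpace ℝ (Fin N) → SU5} {x : EuclideanSpace ℝ (Fin N)}
    (hq : IsPlotAt q x) (h0 : ∀ᶠ y in 𝓝 x, (q y).1 last last ≠ 0) :
    IsPlotAt (fun y => sectionLift (q y)) x := by
  refine isPlotAt_specialUnitary.2 ?_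
  filter_upwards [h0.eventually_nhds, isPlotAt_specialUnitary.1 hq] with y hy hqy i j
  refine ContDiffAt.congr_of_eventuallyEq
    ((contDiffAt_columnMatrix_rotate (v := fun k => (q y).1 k last) hy.self_of_nhds i j).comp
      (f := fun z k => (q z).1 k last) y (contDiffAt_pi.2 fun k => hqy k last)) ?_
  filter_upwards [hy] with z hz
  rw [coe_sectionLift hz]
  rfl

/-- On the cosets `gL` with `g₅₅ ≠ 0`, rotating the last column of `g` so that its last entry
becomes positive gives a section of `SU(5) → SU(5) ⧸ S(U(4) × U(1))`. -/
theorem exists_localSection :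
    ∃ σ : LocalSection SU4U1, (QuotientGroup.mk 1 : SU5 ⧸ SU4U1) ∈ σ.U := by
  classical
  let N : SU5 ⧸ SU4U1 → ℝ := Quotient.lift (fun g => ‖g.1 last last‖) fun a b h => by
    have h' := mul_last_of_mem a (QuotientGroup.leftRel_apply.1 h) last
    rw [mul_inv_cancel_left] at h'
    change ‖a.1 last last‖ = ‖b.1 last last‖
    rw [h', norm_mul, norm_last_of_mem (QuotientGroup.leftRel_apply.1 h), mul_one]
  let τ : SU5 ⧸ SU4U1 → SU5 := Quotient.lift sectionLift fun a b h => by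
    have h' := sectionLift_mul a (QuotientGroup.leftRel_apply.1 h)
    rw [mul_inv_cancel_left] at h'
    exact h'.symm
  have hN : Continuous N := continuous_quot_lift _ (continuous_subtype_val.matrix_elem _ _).norm
  let s : SU5 ⧸ SU4U1 → SU5 := fun b => if N b ≠ 0 then τ b else Quotient.out b
  have hU : IsOpen {b | N b ≠ 0} := isOpen_ne_fun hN continuous_const
  have hs : Set.EqOn s τ {b | N b ≠ 0} := fun b hb => if_pos hb
  refine ⟨⟨s, {b | N b ≠ 0}, hU, fun b => ?_, ?_, ?_⟩, ?_⟩
  · by_cases hb : N b ≠ 0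
    · rw [hs hb]
      induction b using QuotientGroup.induction_on with | _ g => ?_
      exact mk_sectionLift (norm_ne_zero_iff.1 hb)
    · simp only [s, if_neg hb]
      exact Quotient.out_eq' b
  · refine ContinuousOn.congr ?_ hs
    refine (QuotientGroup.isOpenQuotientMap_mk.isQuotientMap.continuousOn_isOpen_iff hU).2 ?_
    exact continuousOn_sectionLift.mono fun g hg => norm_ne_zero_iff.1 hg
  · refine dSmoothOn_of_isPlotAt fun n p hp hpU x => ?_
    obtain ⟨q, hq, hqp⟩ := exists_isPlotAt_lift_coset hp x
    refine (isPlotAt_sectionLift hq (hqp.mono fun y hy => ?_)).congr (hqp.mono fun y hy => ?_)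
    · have := hpU y
      rw [← hy] at this
      exact norm_ne_zero_iff.1 this
    · change τ (QuotientGroup.mk (q y)) = s (p y)
      rw [hy, hs (hpU y)]
  · change ‖(1 : Matrix ((Fin 2 ⊕ Fin 2) ⊕ Unit) ((Fin 2 ⊕ Fin 2) ⊕ Unit) ℂ) last last‖ ≠ 0
    rw [Matrix.one_apply_eq, norm_one]
    exact one_ne_zero

end Base

/-! ### The six-dimensional real representation of `SU(4)` -/

section Skew

/-- The index set of the coordinates of `ℂ⁴`. -/
abbrev I4 : Type := Fin 2 ⊕ Fin 2

/-- The standard symplectic form on `ℂ⁴`. -/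
abbrev J4 : Matrix I4 I4 ℂ := Matrix.J (Fin 2) ℂ

/-- Coordinates on the real form of `Λ²ℂ⁴` formed by the skew-symmetric matrices `S` whose Hodge star
is `Sᴴ`; it is preserved by `S ↦ A S Aᵀ` for `A ∈ SU(4)`. The matrix `J` is the negative of the
basis vector with index `2`. -/
def skew (v : Fin 6 → ℝ) : Matrix I4 I4 ℂ :=
  Matrix.fromBlocks
    !![0, ⟨v 0, v 1⟩; -⟨v 0, v 1⟩, 0]
    !![⟨v 2, v 3⟩, ⟨v 4, v 5⟩; -⟨v 4, -v 5⟩, ⟨v 2, -v 3⟩]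
    !![-⟨v 2, v 3⟩, ⟨v 4, -v 5⟩; -⟨v 4, v 5⟩, -⟨v 2, -v 3⟩]
    !![0, -⟨v 0, -v 1⟩; ⟨v 0, -v 1⟩, 0]

/-- The coordinates of a matrix in the range of `skew`. -/
def coords (S : Matrix I4 I4 ℂ) : Fin 6 → ℝ :=
  ![(S (.inl 0) (.inl 1)).re, (S (.inl 0) (.inl 1)).im, (S (.inl 0) (.inr 0)).re,
    (S (.inl 0) (.inr 0)).im, (S (.inl 0) (.inr 1)).re, (S (.inl 0) (.inr 1)).im]

/-- The square of the Euclidean norm. -/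
def normSq6 (v : Fin 6 → ℝ) : ℝ := ∑ i, v i ^ 2

theorem coords_skew (v : Fin 6 → ℝ) : coords (skew v) = v := by
  funext i
  fin_cases i <;> rfl

theorem coords_smul (t : ℝ) (S : Matrix I4 I4 ℂ) : coords ((t : ℂ) • S) = t • coords S := by
  funext i
  fin_cases i <;> simp [coords]

theorem continuous_coords : Continuous coords := by
  refine continuous_pi fun i => ?_
  fin_cases i <;>
  first
  | exact Complex.continuous_re.comp (continuous_id.matrix_elem _ _)
  | exact Complex.continuous_im.comp (continuous_id.matrix_elem _ _)

theorem contDiffAt_coords {E : Type*} [NormedAddCommGroup E] [NormedSpace ℝ E]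
    {S : E → Matrix I4 I4 ℂ} {x : E} (h : ∀ i j, ContDiffAt ℝ ∞ (fun y => S y i j) x) :
    ContDiffAt ℝ ∞ (fun y => coords (S y)) x := by
  refine contDiffAt_pi.2 fun i => ?_
  fin_cases i <;>
  first
  | exact Complex.reCLM.contDiff.contDiffAt.comp x (h _ _)
  | exact Complex.imCLM.contDiff.contDiffAt.comp x (h _ _)

theorem skew_smul (t : ℝ) (v : Fin 6 → ℝ) : skew (t • v) = (t : ℂ) • skew v := by
  ext i j
  rcases i with i | i <;> rcases j with j | j <;> fin_cases i <;> fin_cases j <;>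
    simp [skew, Complex.ext_iff]

theorem skew_add (v w : Fin 6 → ℝ) : skew (v + w) = skew v + skew w := by
  ext i j
  rcases i with i | i <;> rcases j with j | j <;> fin_cases i <;> fin_cases j <;>
    simp [skew, Complex.ext_iff, add_comm]

theorem contDiff_skew (i j : I4) : ContDiff ℝ ∞ fun v => skew v i j := by
  let l : (Fin 6 → ℝ) →ₗ[ℝ] ℂ :=
    { toFun := fun v => skew v i j
      map_add' := fun v w => by rw [skew_add]; rfl
      map_smul' := fun t v => by rw [skew_smul]; simp }
  exact (LinearMap.toContinuousLinearMap l).contDiff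

theorem skew_J : J4 = skew (-Pi.single 2 1) := by
  ext i j
  rcases i with i | i <;> rcases j with j | j <;> fin_cases i <;> fin_cases j <;>
    simp [skew, Matrix.J, Complex.ext_iff]

/-- The Clifford relation: nonzero elements of the range of `skew` are multiples of unitary
matrices. -/
theorem skew_mul_conjTranspose (v : Fin 6 → ℝ) :
    skew v * (skew v)ᴴ = (normSq6 v : ℂ) • 1 := by
  ext i j
  rcases i with i | i <;> rcases j with j | j <;> fin_cases i <;> fin_cases j <;>
    simp [skew, normSq6, Complex.ext_iff, Matrix.mul_apply, Fin.sum_univ_succ, pow_two] <;>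
    constructor <;> ring

theorem skew_transpose (v : Fin 6 → ℝ) : (skew v)ᵀ = -skew v := by
  ext i j
  rcases i with i | i <;> rcases j with j | j <;> fin_cases i <;> fin_cases j <;>
    simp [skew]

/-- The product is `-|w|²` times the reflection of `J` in the line spanned by `skew w`. -/
theorem skew_mul_J_mul_skew (w : Fin 6 → ℝ) :
    skew w * J4 * skew w = (normSq6 w : ℂ) • J4 + (2 * w 2 : ℂ) • skew w := by
  rw [skew_J]
  ext i j
  rcases i with i | i <;> rcases j with j | j <;> fin_cases i <;> fin_cases j <;>
    simp [skew, normSq6, Complex.ext_iff, Matrix.mul_apply, Fin.sum_univ_succ, pow_two] <;>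
    constructor <;> ring

/-- The Laplace expansion of a determinant of size `4` along the first two rows. -/
theorem det_I4 (A : Matrix I4 I4 ℂ) : A.det =
    (A (.inl 0) (.inl 0) * A (.inl 1) (.inl 1) - A (.inl 0) (.inl 1) * A (.inl 1) (.inl 0)) *
      (A (.inr 0) (.inr 0) * A (.inr 1) (.inr 1) - A (.inr 0) (.inr 1) * A (.inr 1) (.inr 0)) -
    (A (.inl 0) (.inl 0) * A (.inl 1) (.inr 0) - A (.inl 0) (.inr 0) * A (.inl 1) (.inl 0)) *
      (A (.inr 0) (.inl 1) * A (.inr 1) (.inr 1) - A (.inr 0) (.inr 1) * A (.inr 1) (.inl 1)) +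
    (A (.inl 0) (.inl 0) * A (.inl 1) (.inr 1) - A (.inl 0) (.inr 1) * A (.inl 1) (.inl 0)) *
      (A (.inr 0) (.inl 1) * A (.inr 1) (.inr 0) - A (.inr 0) (.inr 0) * A (.inr 1) (.inl 1)) +
    (A (.inl 0) (.inl 1) * A (.inl 1) (.inr 0) - A (.inl 0) (.inr 0) * A (.inl 1) (.inl 1)) *
      (A (.inr 0) (.inl 0) * A (.inr 1) (.inr 1) - A (.inr 0) (.inr 1) * A (.inr 1) (.inl 0)) -
    (A (.inl 0) (.inl 1) * A (.inl 1) (.inr 1) - A (.inl 0) (.inr 1) * A (.inl 1) (.inl 1)) *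
      (A (.inr 0) (.inl 0) * A (.inr 1) (.inr 0) - A (.inr 0) (.inr 0) * A (.inr 1) (.inl 0)) +
    (A (.inl 0) (.inr 0) * A (.inl 1) (.inr 1) - A (.inl 0) (.inr 1) * A (.inl 1) (.inr 0)) *
      (A (.inr 0) (.inl 0) * A (.inr 1) (.inl 1) - A (.inr 0) (.inl 1) * A (.inr 1) (.inl 0)) := by
  rw [← Matrix.det_submatrix_equiv_self (finSumFinEquiv (m := 2) (n := 2)).symm]
  have e0 : (finSumFinEquiv (m := 2) (n := 2)).symm 0 = .inl 0 := rfl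
  have e1 : (finSumFinEquiv (m := 2) (n := 2)).symm 1 = .inl 1 := rfl
  have e2 : (finSumFinEquiv (m := 2) (n := 2)).symm 2 = .inr 0 := rfl
  have e3 : (finSumFinEquiv (m := 2) (n := 2)).symm 3 = .inr 1 := rfl
  simp [Matrix.det_succ_row_zero (n := 3), Matrix.det_fin_three, Fin.sum_univ_four,
    Fin.succAbove]
  rw [e0, e1, e2, e3]
  ring

theorem det_skew (v : Fin 6 → ℝ) : (skew v).det = (normSq6 v : ℂ) ^ 2 := by
  have h : (normSq6 v : ℂ) = ⟨v 0, v 1⟩ * ⟨v 0, -v 1⟩ + ⟨v 2, v 3⟩ * ⟨v 2, -v 3⟩ +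
      ⟨v 4, v 5⟩ * ⟨v 4, -v 5⟩ := by
    simp [normSq6, Complex.ext_iff, Fin.sum_univ_succ, pow_two]
    constructor <;> ring
  rw [det_I4, h]
  simp [skew]
  ring

/-- The Pfaffian of a skew-symmetric matrix. -/
def pf (S : Matrix I4 I4 ℂ) : ℂ :=
  S (.inl 0) (.inl 1) * S (.inr 0) (.inr 1) - S (.inl 0) (.inr 0) * S (.inl 1) (.inr 1) +
    S (.inl 0) (.inr 1) * S (.inl 1) (.inr 0)

/-- The Hodge star of a skew-symmetric matrix. -/
def hodge (S : Matrix I4 I4 ℂ) : Matrix I4 I4 ℂ :=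
  Matrix.fromBlocks
    !![0, S (.inr 0) (.inr 1); -S (.inr 0) (.inr 1), 0]
    !![-S (.inl 1) (.inr 1), S (.inl 1) (.inr 0); S (.inl 0) (.inr 1), -S (.inl 0) (.inr 0)]
    !![S (.inl 1) (.inr 1), -S (.inl 0) (.inr 1); -S (.inl 1) (.inr 0), S (.inl 0) (.inr 0)]
    !![0, S (.inl 0) (.inl 1); -S (.inl 0) (.inl 1), 0]

/-- The Hodge star is, up to the Pfaffian, the inverse of a skew-symmetric matrix. -/
theorem mul_hodge {S : Matrix I4 I4 ℂ} (hS : Sᵀ = -S) : S * hodge S = -pf S • 1 := by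
  have h : ∀ i j, S j i = -S i j := fun i j => congrFun (congrFun hS i) j
  have h0 : ∀ i, S i i = 0 := fun i => self_eq_neg.1 (h i i)
  ext i j
  rcases i with i | i <;> rcases j with j | j <;> fin_cases i <;> fin_cases j <;>
    simp [hodge, pf, Matrix.mul_apply, h0, h (.inl 0) (.inl 1), h (.inr 0) (.inr 1),
      h (.inl 0) (.inr 0), h (.inl 1) (.inr 1), h (.inl 0) (.inr 1), h (.inl 1) (.inr 0)] <;>
    ring

theorem pf_mul_J_mul_transpose (A : Matrix I4 I4 ℂ) : pf (A * J4 * Aᵀ) = -A.det := by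
  rw [det_I4]
  simp [pf, Matrix.mul_apply, Matrix.J]
  ring

theorem J4_transpose : J4ᵀ = -J4 := by
  rw [skew_J, skew_transpose]

theorem J4_mul_J4_conjTranspose : J4 * J4ᴴ = 1 := by
  rw [skew_J, skew_mul_conjTranspose]
  simp [normSq6, Fin.sum_univ_succ]

theorem det_J4 : J4.det = 1 := by
  rw [skew_J, det_skew]
  simp [normSq6, Fin.sum_univ_succ]

theorem det_mul_J_mul_transpose (A : SU4) : (A.1 * J4 * A.1ᵀ).det = 1 := by
  have h : A.1.det = 1 := A.2.2
  simp [Matrix.det_mul, Matrix.det_transpose, h, det_J4]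

/-- The Hodge star of `S = A J Aᵀ` is `Sᴴ`, since both are inverse to `S`. Comparing entries, `S`
lies in the range of `skew`. -/
theorem skew_coords (A : SU4) :
    skew (coords (A.1 * J4 * A.1ᵀ)) = A.1 * J4 * A.1ᵀ := by
  have hA : A.1 * A.1ᴴ = 1 := A.2.1.2
  have hA' : A.1ᵀ * (A.1ᵀ)ᴴ = 1 := by
    have h : A.1ᴴ * A.1 = 1 := A.2.1.1
    change A.1ᵀ * (A.1ᴴ)ᵀ = 1
    rw [← Matrix.transpose_mul, h, Matrix.transpose_one]
  have hpf : pf (A.1 * J4 * A.1ᵀ) = -1 := by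
    have h : A.1.det = 1 := A.2.2
    rw [pf_mul_J_mul_transpose, h]
  have hS : (A.1 * J4 * A.1ᵀ)ᵀ = -(A.1 * J4 * A.1ᵀ) := by
    simp only [Matrix.transpose_mul, Matrix.transpose_transpose, J4_transpose, Matrix.mul_neg,
      Matrix.neg_mul, Matrix.mul_assoc]
  have hSS : (A.1 * J4 * A.1ᵀ) * (A.1 * J4 * A.1ᵀ)ᴴ = 1 := by
    rw [Matrix.conjTranspose_mul, Matrix.conjTranspose_mul]
    calc _ = A.1 * (J4 * (A.1ᵀ * (A.1ᵀ)ᴴ) * J4ᴴ) * A.1ᴴ := by simp only [Matrix.mul_assoc]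
      _ = 1 := by rw [hA', Matrix.mul_one, J4_mul_J4_conjTranspose, Matrix.mul_one, hA]
  generalize A.1 * J4 * A.1ᵀ = S at *
  have hh : hodge S = Sᴴ := by
    have h1 := mul_hodge hS
    rw [hpf, neg_neg, one_smul] at h1
    calc hodge S = (Sᴴ * S) * hodge S := by rw [mul_eq_one_comm.1 hSS, one_mul]
      _ = Sᴴ := by rw [mul_assoc, h1, mul_one]
  have h : ∀ i j, S j i = -S i j := fun i j => congrFun (congrFun hS i) j
  have h0 : ∀ i, S i i = 0 := fun i => self_eq_neg.1 (h i i)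
  have h34 : S (.inr 0) (.inr 1) = -star (S (.inl 0) (.inl 1)) := by
    have h1 : S (.inr 0) (.inr 1) = star (S (.inl 1) (.inl 0)) :=
      congrFun (congrFun hh (.inl 0)) (.inl 1)
    rw [h1, h (.inl 0) (.inl 1), star_neg]
  have h24 : S (.inl 1) (.inr 1) = star (S (.inl 0) (.inr 0)) := by
    have h1 : -S (.inl 1) (.inr 1) = star (S (.inr 0) (.inl 0)) :=
      congrFun (congrFun hh (.inl 0)) (.inr 0)
    rw [h (.inl 0) (.inr 0), star_neg] at h1
    exact neg_injective h1
  have h23 : S (.inl 1) (.inr 0) = -star (S (.inl 0) (.inr 1)) := by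
    have h1 : S (.inl 1) (.inr 0) = star (S (.inr 1) (.inl 0)) :=
      congrFun (congrFun hh (.inl 0)) (.inr 1)
    rw [h1, h (.inl 0) (.inr 1), star_neg]
  ext i j
  rcases i with i | i <;> rcases j with j | j <;> fin_cases i <;> fin_cases j <;>
    simp [skew, coords, h0, h (.inl 0) (.inl 1), h (.inr 0) (.inr 1),
      h (.inl 0) (.inr 0), h (.inl 1) (.inr 1), h (.inl 0) (.inr 1), h (.inl 1) (.inr 0),
      h34, h24, h23, Complex.ext_iff]

end Skew

/-! ### The quotient `SU(4) ⧸ (SU(4) ∩ H)` as a real projective space -/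

section RealProjective

/-- The group `SU(4) ∩ H` is `Sp(2) ∪ i Sp(2)`, the stabilizer of the line spanned by `J`. -/
theorem mem_SU4capH_iff {g : SU4} : g ∈ SU4capH ↔
    g.1 * J4 * g.1ᵀ = J4 ∨ g.1 * J4 * g.1ᵀ = -J4 := by
  constructor
  · rintro ⟨P, hP, z, h⟩
    have h' : Matrix.fromBlocks g.1 0 0 1 = Matrix.fromBlocks ((z : ℂ) • P.1) 0 0
      (star (z : ℂ) ^ 4 • (1 : Matrix Unit Unit ℂ)) := h
    rw [Matrix.fromBlocks_inj] at h'
    obtain ⟨h1, -, -, h2⟩ := h'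
    have h3 : star (z : ℂ) ^ 4 = 1 := by simpa using (congrFun (congrFun h2 ()) ()).symm
    have h4 : (z : ℂ) ^ 4 = 1 := by
      have := congrArg star h3
      rwa [star_pow, star_star, star_one] at this
    have h5 : P.1 * J4 * P.1ᵀ = J4 := hP
    have h6 : g.1 * J4 * g.1ᵀ = ((z : ℂ) ^ 2) • J4 := by
      rw [h1, Matrix.transpose_smul, Matrix.smul_mul, Matrix.smul_mul, Matrix.mul_smul, h5,
        smul_smul, sq]
    have h7 : (z : ℂ) ^ 2 * (z : ℂ) ^ 2 = 1 := by rw [← pow_add]; exact h4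
    rcases mul_self_eq_one_iff.1 h7 with h7 | h7
    · left; rw [h6, h7, one_smul]
    · right; rw [h6, h7, neg_smul, one_smul]
  · rintro (h | h)
    · exact ⟨g, h, 1, by simp [inclSU4]⟩
    · -- Here `g = i P` with `P ∈ Sp(2)`, and `i⁴ = 1`.
      have hI4 : (-Complex.I) ^ 4 = 1 := by rw [neg_pow, Complex.I_pow_four]; norm_num
      have hP : (-Complex.I) • g.1 ∈ Matrix.specialUnitaryGroup I4 ℂ := by
        have h1 : g.1 * star g.1 = 1 := g.2.1.2
        have h2 : g.1.det = 1 := g.2.2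
        rw [Matrix.mem_specialUnitaryGroup_iff, Matrix.mem_unitaryGroup_iff, star_smul,
          smul_mul_smul_comm, h1, Matrix.det_smul, h2]
        simp [hI4]
      refine ⟨⟨_, hP⟩, ?_, ⟨Complex.I, by simp [Submonoid.unitSphere]⟩, ?_⟩
      · change ((-Complex.I) • g.1) * J4 * ((-Complex.I) • g.1)ᵀ = J4
        rw [Matrix.transpose_smul, Matrix.smul_mul, Matrix.smul_mul, Matrix.mul_smul, h,
          smul_smul]
        simp
      · change Matrix.fromBlocks g.1 0 0 1 = Matrix.fromBlocks (Complex.I • (-Complex.I) • g.1) 0 0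
          (star Complex.I ^ 4 • (1 : Matrix Unit Unit ℂ))
        rw [smul_smul]
        simp [hI4]

theorem coords_ne_zero (A : SU4) : coords (A.1 * J4 * A.1ᵀ) ≠ 0 := by
  intro h
  have h1 := det_mul_J_mul_transpose A
  rw [← skew_coords, h, det_skew] at h1
  simp [normSq6] at h1

/-- The cosets of `SU(4) ∩ H` are the lines spanned by the matrices `A J Aᵀ`. -/
theorem inv_mul_mem_SU4capH_iff (a b : SU4) : a⁻¹ * b ∈ SU4capH ↔
    ∃ t : ℝ, t • coords (b.1 * J4 * b.1ᵀ) = coords (a.1 * J4 * a.1ᵀ) := by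
  have hinv : a.1 * (a⁻¹).1 = 1 := a.2.1.2
  have hinv' : (a⁻¹).1 * a.1 = 1 := a.2.1.1
  have hb : (a⁻¹ * b).1 * J4 * (a⁻¹ * b).1ᵀ = (a⁻¹).1 * (b.1 * J4 * b.1ᵀ) * (a⁻¹).1ᵀ := by
    change ((a⁻¹).1 * b.1) * J4 * ((a⁻¹).1 * b.1)ᵀ = _
    rw [Matrix.transpose_mul]
    simp only [Matrix.mul_assoc]
  have hJ : (a⁻¹).1 * (a.1 * J4 * a.1ᵀ) * (a⁻¹).1ᵀ = J4 := by
    calc _ = ((a⁻¹).1 * a.1) * J4 * ((a⁻¹).1 * a.1)ᵀ := by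
          rw [Matrix.transpose_mul]; simp only [Matrix.mul_assoc]
      _ = J4 := by rw [hinv', Matrix.transpose_one, Matrix.mul_one, Matrix.one_mul]
  have hback : ∀ S : Matrix I4 I4 ℂ, a.1 * ((a⁻¹).1 * S * (a⁻¹).1ᵀ) * a.1ᵀ = S := fun S => by
    calc _ = (a.1 * (a⁻¹).1) * S * (a.1 * (a⁻¹).1)ᵀ := by
          rw [Matrix.transpose_mul]; simp only [Matrix.mul_assoc]
      _ = S := by rw [hinv, Matrix.transpose_one, Matrix.mul_one, Matrix.one_mul]
  rw [mem_SU4capH_iff, hb]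
  constructor
  · rintro (h | h)
    · refine ⟨1, ?_⟩
      rw [← hback (b.1 * J4 * b.1ᵀ), h, one_smul]
    · refine ⟨-1, ?_⟩
      rw [← hback (b.1 * J4 * b.1ᵀ), h, ← coords_smul]
      simp
  · rintro ⟨t, ht⟩
    have h1 : (t : ℂ) • (b.1 * J4 * b.1ᵀ) = a.1 * J4 * a.1ᵀ := by
      rw [← skew_coords a, ← ht, skew_smul, skew_coords]
    have h2 : t ^ 4 = 1 := by
      have h3 := congrArg Matrix.det h1
      rw [Matrix.det_smul, det_mul_J_mul_transpose, det_mul_J_mul_transpose, mul_one] at h3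
      have h4 : (t : ℂ) ^ 4 = 1 := h3
      exact_mod_cast h4
    have h3 : t = 1 ∨ t = -1 := by
      have h4 : t ^ 2 = 1 := (pow_eq_one_iff_of_nonneg (sq_nonneg t) two_ne_zero).1
        (by rw [← pow_mul]; exact h2)
      exact sq_eq_one_iff.1 h4
    rcases h3 with rfl | rfl
    · left
      rw [Complex.ofReal_one, one_smul] at h1
      rw [h1, hJ]
    · right
      have h4 : b.1 * J4 * b.1ᵀ = -(a.1 * J4 * a.1ᵀ) := by
        rw [← h1]
        simp
      rw [h4, Matrix.mul_neg, Matrix.neg_mul, hJ]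

/-- The vector `v + |v| J`; the reflection in the line it spans maps `|v| J` to `v`. -/
def bisector (v : Fin 6 → ℝ) : Fin 6 → ℝ :=
  v - Real.sqrt (normSq6 v) • Pi.single 2 1

/-- A matrix `A ∈ SU(4)` for which `A J Aᵀ` has the direction of `v`. In terms of the Clifford
multiplication on the range of `skew` it is the product of `J` and the unit vector bisecting the
angle between `J` and `v`. -/
def bisectorMatrix (v : Fin 6 → ℝ) : Matrix I4 I4 ℂ :=
  ((Real.sqrt (normSq6 (bisector v)) : ℂ)⁻¹) • (skew (bisector v) * J4)

variable {v : Fin 6 → ℝ}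

theorem normSq6_nonneg (v : Fin 6 → ℝ) : 0 ≤ normSq6 v :=
  Finset.sum_nonneg fun i _ => sq_nonneg (v i)

theorem normSq6_pos (hv : v ≠ 0) : 0 < normSq6 v := by
  obtain ⟨j, hj⟩ := Function.ne_iff.1 hv
  exact Finset.sum_pos' (fun k _ => sq_nonneg _) ⟨j, Finset.mem_univ j, sq_pos_of_ne_zero hj⟩

theorem normSq6_bisector (v : Fin 6 → ℝ) :
    normSq6 (bisector v) = -2 * Real.sqrt (normSq6 v) * bisector v 2 := by
  have h := Real.mul_self_sqrt (normSq6_nonneg v)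
  unfold bisector
  generalize Real.sqrt (normSq6 v) = r at *
  simp only [normSq6, Fin.sum_univ_six] at h ⊢
  simp
  linear_combination -h

theorem normSq6_bisector_pos (hv : v ≠ 0) (h : Real.sqrt (normSq6 v) ≠ v 2) :
    0 < normSq6 (bisector v) := by
  refine (normSq6_nonneg _).lt_of_ne' ?_
  rw [normSq6_bisector]
  have h1 : bisector v 2 ≠ 0 := by
    simpa [bisector, sub_eq_zero] using h.symm
  exact mul_ne_zero (mul_ne_zero (by norm_num) (Real.sqrt_pos.2 (normSq6_pos hv)).ne') h1

theorem bisectorMatrix_mem (hw : 0 < normSq6 (bisector v)) :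
    bisectorMatrix v ∈ Matrix.specialUnitaryGroup I4 ℂ := by
  have h0 : (Real.sqrt (normSq6 (bisector v)) : ℂ) ≠ 0 :=
    Complex.ofReal_ne_zero.2 (Real.sqrt_pos.2 hw).ne'
  have h1 : (Real.sqrt (normSq6 (bisector v)) : ℂ) * Real.sqrt (normSq6 (bisector v)) =
      normSq6 (bisector v) := by
    rw [← Complex.ofReal_mul, Real.mul_self_sqrt hw.le]
  have h2 : star (Real.sqrt (normSq6 (bisector v)) : ℂ)⁻¹ =
      (Real.sqrt (normSq6 (bisector v)) : ℂ)⁻¹ := by simp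
  rw [Matrix.mem_specialUnitaryGroup_iff, Matrix.mem_unitaryGroup_iff]
  constructor
  · rw [bisectorMatrix, star_smul, smul_mul_smul_comm, h2, Matrix.star_eq_conjTranspose,
      Matrix.conjTranspose_mul]
    have h3 : skew (bisector v) * J4 * (J4ᴴ * (skew (bisector v))ᴴ) =
        (normSq6 (bisector v) : ℂ) • 1 := by
      rw [← Matrix.mul_assoc, Matrix.mul_assoc _ J4, J4_mul_J4_conjTranspose, Matrix.mul_one,
        skew_mul_conjTranspose]
    rw [h3, smul_smul, ← h1]
    field_simp
    exact one_smul _ _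
  · rw [bisectorMatrix, Matrix.det_smul, Matrix.det_mul, det_J4, det_skew, ← h1]
    have h4 : Fintype.card I4 = 4 := rfl
    rw [h4]
    field_simp

theorem bisectorMatrix_mul_J_mul_transpose (hv : v ≠ 0) (hw : 0 < normSq6 (bisector v)) :
    bisectorMatrix v * J4 * (bisectorMatrix v)ᵀ =
      (((Real.sqrt (normSq6 v))⁻¹ : ℝ) : ℂ) • skew v := by
  have hr : (Real.sqrt (normSq6 v) : ℂ) ≠ 0 :=
    Complex.ofReal_ne_zero.2 (Real.sqrt_pos.2 (normSq6_pos hv)).ne'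
  have h0 : (Real.sqrt (normSq6 (bisector v)) : ℂ) ≠ 0 :=
    Complex.ofReal_ne_zero.2 (Real.sqrt_pos.2 hw).ne'
  have h1 : (Real.sqrt (normSq6 (bisector v)) : ℂ) * Real.sqrt (normSq6 (bisector v)) =
      normSq6 (bisector v) := by
    rw [← Complex.ofReal_mul, Real.mul_self_sqrt hw.le]
  have h2 : (normSq6 (bisector v) : ℂ) = -2 * Real.sqrt (normSq6 v) * bisector v 2 := by
    rw [normSq6_bisector]
    push_cast
    rfl
  have h3 : skew (bisector v) = skew v + (Real.sqrt (normSq6 v) : ℂ) • J4 := by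
    rw [skew_J, ← skew_smul, ← skew_add, bisector, smul_neg, sub_eq_add_neg]
  have hJ : J4 * J4 = -1 := Matrix.J_squared _ _
  have h4 : skew (bisector v) * J4 * J4 * (skew (bisector v) * J4)ᵀ =
      -(skew (bisector v) * J4 * skew (bisector v)) := by
    rw [Matrix.transpose_mul, J4_transpose, skew_transpose, Matrix.mul_assoc (skew _), hJ]
    simp [Matrix.mul_assoc]
  rw [bisectorMatrix, Matrix.transpose_smul, Matrix.smul_mul, Matrix.smul_mul, Matrix.mul_smul,
    smul_smul, h4, skew_mul_J_mul_skew, h2]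
  have hw2 : (bisector v 2 : ℂ) ≠ 0 := fun h => by
    rw [h, mul_zero] at h2
    exact hw.ne' (by exact_mod_cast h2)
  have h5 : (Real.sqrt (normSq6 (bisector v)) : ℂ)⁻¹ * (Real.sqrt (normSq6 (bisector v)) : ℂ)⁻¹ =
      -(2 * bisector v 2 * Real.sqrt (normSq6 v) : ℂ)⁻¹ := by
    rw [← mul_inv, h1, h2, ← inv_neg]
    ring_nf
  rw [h5]
  rw [h3]
  ext i j
  simp only [Matrix.smul_apply, Matrix.neg_apply, Matrix.add_apply, smul_eq_mul,
    Complex.ofReal_inv]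
  field_simp
  ring

theorem contDiff_normSq6 : ContDiff ℝ ∞ normSq6 :=
  ContDiff.sum fun i _ => (contDiff_apply ℝ ℝ i).pow 2

theorem contDiffAt_bisector (hv : v ≠ 0) : ContDiffAt ℝ ∞ bisector v :=
  contDiffAt_id.sub ((contDiff_normSq6.contDiffAt.sqrt (normSq6_pos hv).ne').smul contDiffAt_const)

theorem contDiffAt_bisectorMatrix (hv : v ≠ 0) (hw : 0 < normSq6 (bisector v)) (i j : I4) :
    ContDiffAt ℝ ∞ (fun v => bisectorMatrix v i j) v := by
  have h1 : ContDiffAt ℝ ∞ (fun v => (Real.sqrt (normSq6 (bisector v)) : ℂ)⁻¹) v :=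
    (Complex.ofRealCLM.contDiff.contDiffAt.comp v
      ((contDiff_normSq6.contDiffAt.comp v (contDiffAt_bisector hv)).sqrt hw.ne')).inv
      (Complex.ofReal_ne_zero.2 (Real.sqrt_pos.2 hw).ne')
  exact h1.mul (contDiffAt_matrix_mul (A := fun v => skew (bisector v)) (B := fun _ => J4) (fun i k => (contDiff_skew i k).contDiffAt.comp v
    (contDiffAt_bisector hv)) (fun _ _ => contDiffAt_const) i j)

open scoped Classical in
/-- The element of `SU(4)` given by `bisectorMatrix`; the value at nonnegative multiples of `-J`
is irrelevant. -/
def bisectorSU4 (v : Fin 6 → ℝ) : SU4 :=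
  if h : bisectorMatrix v ∈ Matrix.specialUnitaryGroup I4 ℂ then ⟨_, h⟩ else 1

theorem coe_bisectorSU4 (hw : 0 < normSq6 (bisector v)) :
    (bisectorSU4 v).1 = bisectorMatrix v := by
  rw [bisectorSU4, dif_pos (bisectorMatrix_mem hw)]

/-- A smooth family of nonzero vectors avoiding the positive multiples of `-J` lifts to `SU(4)`,
up to positive factors. -/
theorem exists_isPlotAt_bisector {n : ℕ} {w : EuclideanSpace ℝ (Fin n) → Fin 6 → ℝ}
    {x : EuclideanSpace ℝ (Fin n)} (hw : ∀ᶠ y in 𝓝 x, ContDiffAt ℝ ∞ w y) (hne : ∀ y, w y ≠ 0)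
    (hx : Real.sqrt (normSq6 (w x)) ≠ w x 2) :
    ∃ q : EuclideanSpace ℝ (Fin n) → SU4, IsPlotAt q x ∧ ∀ᶠ y in 𝓝 x,
      (Real.sqrt (normSq6 (w y)))⁻¹ • w y = coords ((q y).1 * J4 * (q y).1ᵀ) := by
  have hb : ∀ᶠ y in 𝓝 x, 0 < normSq6 (bisector (w y)) := by
    have h1 : ContinuousAt (fun y => normSq6 (bisector (w y))) x :=
      contDiff_normSq6.continuous.continuousAt.comp
        ((contDiffAt_bisector (hne x)).continuousAt.comp hw.self_of_nhds.continuousAt)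
    exact h1.eventually (lt_mem_nhds (normSq6_bisector_pos (hne x) hx))
  refine ⟨fun y => bisectorSU4 (w y), isPlotAt_specialUnitary.2 ?_, ?_⟩
  · filter_upwards [hw, hb.eventually_nhds] with y hw hb i j
    refine ContDiffAt.congr_of_eventuallyEq
      ((contDiffAt_bisectorMatrix (hne y) hb.self_of_nhds i j).comp y hw) ?_
    filter_upwards [hb] with z hz
    rw [coe_bisectorSU4 hz]
    rfl
  · filter_upwards [hb] with y hb
    rw [coe_bisectorSU4 hb, bisectorMatrix_mul_J_mul_transpose (hne y) hb, coords_smul,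
      coords_skew]

theorem exists_diffeo_realProjective :
    Nonempty (Diffeo (SU4 ⧸ SU4capH) (ℙ ℝ (Fin 6 → ℝ))) := by
  let c : SU4 → {v : Fin 6 → ℝ // v ≠ 0} := fun A => ⟨coords (A.1 * J4 * A.1ᵀ), coords_ne_zero A⟩
  refine (exists_diffeo_of_local_lifts SU4capH (fun A => Projectivization.mk' ℝ (c A))
    ?_ ?_ ?_ ?_).elim fun Φ _ => ⟨Φ⟩
  · refine continuous_projectivization_mk'.comp (continuous_induced_rng.2 ?_)
    have h1 : Continuous fun A : SU4 => A.1 * J4 * A.1ᵀ :=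
      (continuous_subtype_val.mul continuous_const).mul continuous_subtype_val.matrix_transpose
    exact continuous_coords.comp h1
  · refine dSmooth_of_isPlotAt fun n p hp x => isPlotAt_projectivization ?_
    filter_upwards [isPlotAt_specialUnitary.1 (hp.isPlotAt x)] with y hy
    exact contDiffAt_coords (contDiffAt_matrix_mul (A := fun y => (p y).1 * J4)
      (B := fun y => (p y).1ᵀ) (contDiffAt_matrix_mul (A := fun y => (p y).1) (B := fun _ => J4) hy
        fun _ _ => contDiffAt_const) fun i j => hy j i)
  · intro a b
    rw [inv_mul_mem_SU4capH_iff]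
    exact Projectivization.mk_eq_mk_iff' ℝ _ _ (c a).2 (c b).2
  · intro n p hp x
    obtain ⟨v, hv, hvp⟩ := exists_lift_projectivization hp x
    -- Of the vectors `±v` at least one is not a positive multiple of `-J`.
    obtain ⟨ε, hε, hεx⟩ : ∃ ε : ℝ, ε ≠ 0 ∧
        Real.sqrt (normSq6 (ε • (v x).1)) ≠ (ε • (v x).1) 2 := by
      by_cases h : Real.sqrt (normSq6 (v x).1) = (v x).1 2
      · refine ⟨-1, by norm_num, fun h' => ?_⟩
        have h1 := Real.sqrt_pos.2 (normSq6_pos (v x).2)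
        have h2 : normSq6 ((-1 : ℝ) • (v x).1) = normSq6 (v x).1 := by simp [normSq6]
        rw [h2, h, Pi.smul_apply, smul_eq_mul] at h'
        linarith
      · exact ⟨1, one_ne_zero, by simpa using h⟩
    obtain ⟨q, hq, hqw⟩ := exists_isPlotAt_bisector (w := fun y => ε • (v y).1)
      (hv.mono fun y hy => hy.const_smul ε) (fun y => smul_ne_zero hε (v y).2) hεx
    refine ⟨q, hq, ?_⟩
    filter_upwards [hqw, hvp] with y hy hvp
    rw [← hvp]
    refine (Projectivization.mk_eq_mk_iff' ℝ _ _ (c (q y)).2 (v y).2).2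
      ⟨(Real.sqrt (normSq6 (ε • (v y).1)))⁻¹ * ε, ?_⟩
    rw [← smul_smul]
    exact hy

end RealProjective

/-! ### The fibre -/

section Fibre

variable {n : ℕ}

theorem t2Space_coset {G : Type*} [Group G] [TopologicalSpace G] [IsTopologicalGroup G]
    {K : Subgroup G} (hK : IsClosed (K : Set G)) : T2Space (G ⧸ K) := by
  rw [t2Space_iff_of_isOpenQuotientMap QuotientGroup.isOpenQuotientMap_mk]
  have h : {q : G × G | (QuotientGroup.mk q.1 : G ⧸ K) = QuotientGroup.mk q.2} =
      (fun q : G × G => q.1⁻¹ * q.2) ⁻¹' K := by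
    ext q
    exact QuotientGroup.eq
  rw [h]
  exact hK.preimage (continuous_fst.inv.mul continuous_snd)

theorem isClosed_Sp2 : IsClosed (Sp2 : Set SU4) := by
  have h : (Sp2 : Set SU4) = {A : SU4 | A.1 * J4 * A.1ᵀ = J4} := rfl
  rw [h]
  exact isClosed_eq ((continuous_subtype_val.mul continuous_const).mul
    continuous_subtype_val.matrix_transpose) continuous_const

theorem isClosed_H : IsClosed (H : Set SU5) := by
  let f : SU4 × Circle → Matrix (I4 ⊕ Unit) (I4 ⊕ Unit) ℂ := fun q =>
    Matrix.fromBlocks ((q.2 : ℂ) • q.1.1) 0 0 (star (q.2 : ℂ) ^ 4 • (1 : Matrix Unit Unit ℂ))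
  have hf : Continuous f := by
    have h1 : Continuous fun q : SU4 × Circle => (q.2 : ℂ) :=
      continuous_subtype_val.comp continuous_snd
    exact (h1.smul (continuous_subtype_val.comp continuous_fst)).matrix_fromBlocks continuous_const
      continuous_const ((h1.star.pow 4).smul continuous_const)
  have hH : (H : Set SU5) = Subtype.val ⁻¹' (f '' ((Sp2 : Set SU4) ×ˢ Set.univ)) := by
    ext g
    constructor
    · rintro ⟨A, hA, z, h⟩
      exact ⟨(A, z), ⟨hA, trivial⟩, h.symm⟩
    · rintro ⟨⟨A, z⟩, ⟨hA, -⟩, h⟩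
      exact ⟨A, hA, z, h.symm⟩
  rw [hH]
  exact ((isClosed_Sp2.isCompact.prod isCompact_univ).image hf).isClosed.preimage
    continuous_subtype_val

theorem continuous_inclSU4 : Continuous inclSU4 :=
  continuous_induced_rng.2 (continuous_subtype_val.matrix_fromBlocks continuous_const
    continuous_const continuous_const)

theorem dSmooth_inclSU4 : DSmooth inclSU4 := dSmooth_of_isPlotAt fun n p hp x => by
  refine isPlotAt_specialUnitary.2 ?_
  filter_upwards [isPlotAt_specialUnitary.1 (hp.isPlotAt x)] with y hy i j
  rcases i with i | i <;> rcases j with j | j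
  · exact hy i j
  all_goals exact contDiffAt_const

/-- If `g = diag(A, d)` and `r⁴ = d`, then `r A` lies in `SU(4)`, and `g = diag(r A, 1) h` with
`h = diag(r̄, d) ∈ H`. -/
theorem exists_inclSU4_inv_mul_mem {g : SU5} (hg : g ∈ SU4U1) {r : ℂ}
    (hr : r ^ 4 = g.1 last last) :
    ∃ a : SU4, a.1 = r • g.1.toBlocks₁₁ ∧ (inclSU4 a)⁻¹ * g ∈ H := by
  have hd := norm_last_of_mem hg
  have hr1 : ‖r‖ = 1 := (pow_eq_one_iff_of_nonneg (norm_nonneg r) four_ne_zero).1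
    (by rw [← norm_pow, hr, hd])
  have hrr : r * star r = 1 := by
    have := Complex.mul_conj' r
    rw [hr1] at this
    simpa using this
  obtain ⟨A, hA, d, -, h⟩ := hg
  have hdd : g.1 last last = d () () := by rw [h]; rfl
  have hgA : g.1.toBlocks₁₁ = A := by rw [h, Matrix.toBlocks_fromBlocks₁₁]
  have hdet : A.det * d () () = 1 := by
    have h1 : g.1.det = 1 := g.2.2
    rw [h, Matrix.det_fromBlocks_zero₂₁] at h1
    simpa using h1
  have hmem : r • A ∈ Matrix.specialUnitaryGroup I4 ℂ := by
    rw [Matrix.mem_specialUnitaryGroup_iff, Matrix.mem_unitaryGroup_iff, star_smul,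
      smul_mul_smul_comm, hA.2, hrr, one_smul, Matrix.det_smul]
    refine ⟨rfl, ?_⟩
    have h4 : Fintype.card I4 = 4 := rfl
    rw [h4, hr, hdd, mul_comm, hdet]
  refine ⟨⟨r • A, hmem⟩, by rw [hgA], 1, one_mem _,
    ⟨star r, by simp [Submonoid.unitSphere, hr1]⟩, ?_⟩
  change star (Matrix.fromBlocks (r • A) 0 0 (1 : Matrix Unit Unit ℂ)) * g.1 =
    Matrix.fromBlocks (star r • (1 : Matrix I4 I4 ℂ)) 0 0
      (star (star r) ^ 4 • (1 : Matrix Unit Unit ℂ))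
  have hd1 : d = r ^ 4 • (1 : Matrix Unit Unit ℂ) := by
    ext i j
    rw [hr, hdd]
    simp
  have hA1 : Aᴴ * A = 1 := hA.1
  rw [h, star_star, ← hd1, Matrix.star_eq_conjTranspose, Matrix.fromBlocks_conjTranspose,
    Matrix.fromBlocks_multiply]
  simp [hA1]

/-- A smooth family in `S(U(4) × U(1))` is locally congruent modulo `H` to a smooth family in
`SU(4)`, since nonvanishing smooth functions locally have smooth fourth roots. -/
theorem exists_isPlotAt_SU4 {p : EuclideanSpace ℝ (Fin n) → SU5} {x : EuclideanSpace ℝ (Fin n)}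
    (hp : IsPlotAt p x) (hL : ∀ᶠ y in 𝓝 x, p y ∈ SU4U1) :
    ∃ a : EuclideanSpace ℝ (Fin n) → SU4, IsPlotAt a x ∧
      ∀ᶠ y in 𝓝 x, (inclSU4 (a y))⁻¹ * p y ∈ H := by
  classical
  have hp' := isPlotAt_specialUnitary.1 hp
  have hd0 : (p x).1 last last ≠ 0 := by
    rw [← norm_ne_zero_iff, norm_last_of_mem hL.self_of_nhds]
    exact one_ne_zero
  obtain ⟨ζ, hζ⟩ := IsAlgClosed.exists_pow_nat_eq ((p x).1 last last) (n := 4) (by norm_num)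
  let w : EuclideanSpace ℝ (Fin n) → ℂ := fun y => (p y).1 last last / (p x).1 last last
  have hw : ∀ᶠ y in 𝓝 x, ContDiffAt ℝ ∞ w y := hp'.mono fun y hy =>
    (hy last last).div_const _
  have hws : ∀ᶠ y in 𝓝 x, w y ∈ Complex.slitPlane := by
    refine hw.self_of_nhds.continuousAt.eventually (Complex.isOpen_slitPlane.mem_nhds ?_)
    have h1 : w x = 1 := div_self hd0
    rw [h1]
    exact Complex.one_mem_slitPlane
  let r : EuclideanSpace ℝ (Fin n) → ℂ := fun y => ζ * Complex.exp (Complex.log (w y) / 4)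
  have hr : ∀ᶠ y in 𝓝 x, r y ^ 4 = (p y).1 last last := hws.mono fun y hy => by
    simp only [r]
    rw [mul_pow, hζ, ← Complex.exp_nat_mul]
    have h1 : ((4 : ℕ) : ℂ) * (Complex.log (w y) / 4) = Complex.log (w y) := by
      push_cast
      ring
    rw [h1, Complex.exp_log (Complex.slitPlane_ne_zero hy)]
    exact mul_div_cancel₀ _ hd0
  have hrs : ∀ᶠ y in 𝓝 x, ContDiffAt ℝ ∞ r y := by
    filter_upwards [hw, hws] with y hw hws
    have h1 : ContDiffAt ℝ ∞ (fun z => Complex.log (w z)) y :=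
      ((Complex.contDiffAt_log hws).restrict_scalars ℝ).comp y hw
    exact contDiffAt_const.mul (h1.div_const 4).cexp
  let a : EuclideanSpace ℝ (Fin n) → SU4 := fun y =>
    if h : r y • (p y).1.toBlocks₁₁ ∈ Matrix.specialUnitaryGroup I4 ℂ then ⟨_, h⟩ else 1
  have ha : ∀ᶠ y in 𝓝 x,
      (a y).1 = r y • (p y).1.toBlocks₁₁ ∧ (inclSU4 (a y))⁻¹ * p y ∈ H := by
    filter_upwards [hr, hL] with y hr hL
    obtain ⟨b, hb, hbH⟩ := exists_inclSU4_inv_mul_mem hL hr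
    have hab : a y = b := by
      have h1 : r y • (p y).1.toBlocks₁₁ ∈ Matrix.specialUnitaryGroup I4 ℂ := hb ▸ b.2
      simp only [a, dif_pos h1]
      exact Subtype.ext hb.symm
    rw [hab]
    exact ⟨hb, hbH⟩
  refine ⟨a, isPlotAt_specialUnitary.2 ?_, ha.mono fun y hy => hy.2⟩
  filter_upwards [ha.eventually_nhds, hrs, hp'] with y ha hr hp i j
  refine ContDiffAt.congr_of_eventuallyEq (hr.mul (hp (Sum.inl i) (Sum.inl j))) ?_
  filter_upwards [ha] with z hz
  rw [hz.1]
  rfl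

theorem exists_diffeo_fibre :
    ∃ Φ : Diffeo (SU4 ⧸ SU4capH) (SU4U1 ⧸ H.subgroupOf SU4U1),
      ∀ a : SU4, Φ.toHomeomorph (QuotientGroup.mk a) =
        QuotientGroup.mk (⟨inclSU4 a, inclSU4_mem a⟩ : SU4U1) := by
  have hcl : IsClosed ((H.subgroupOf SU4U1 : Subgroup SU4U1) : Set SU4U1) :=
    isClosed_H.preimage continuous_subtype_val
  have := t2Space_coset hcl
  refine exists_diffeo_of_local_lifts SU4capH
    (fun a => QuotientGroup.mk (⟨inclSU4 a, inclSU4_mem a⟩ : SU4U1)) ?_ ?_ ?_ ?_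
  · exact QuotientGroup.continuous_mk.comp (continuous_induced_rng.2 continuous_inclSU4)
  · have h : DSmooth fun a => (⟨inclSU4 a, inclSU4_mem a⟩ : SU4U1) := dSmooth_inclSU4
    exact (dSmooth_mk _).comp h
  · intro a b
    rw [QuotientGroup.eq, Subgroup.mem_subgroupOf, Subgroup.mem_comap, map_mul, map_inv]
    rfl
  · intro n p hp x
    obtain ⟨q, hq, hqp⟩ := exists_isPlotAt_lift_coset hp x
    have hq' : IsPlotAt (fun y => (q y : SU5)) x := hq
    obtain ⟨a, ha, haq⟩ := exists_isPlotAt_SU4 hq' (.of_forall fun y => (q y).2)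
    refine ⟨a, ha, ?_⟩
    filter_upwards [haq, hqp] with y hy hqp
    rw [← hqp]
    exact QuotientGroup.eq.2 hy

theorem exists_diffeo_fibre_smul (g : SU5) :
    ∃ Φ : Diffeo (SU4 ⧸ SU4capH) (proj ⁻¹' {QuotientGroup.mk g}),
      ∀ a : SU4, (Φ.toHomeomorph (QuotientGroup.mk a) : B13) =
        g • (QuotientGroup.mk (inclSU4 a) : B13) := by
  have := t2Space_coset isClosed_H
  have hmem : ∀ a : SU4, g • (QuotientGroup.mk (inclSU4 a) : B13) ∈
      proj ⁻¹' {QuotientGroup.mk g} := fun a =>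
    QuotientGroup.mk_mul_of_mem g (inclSU4_mem a)
  refine (exists_diffeo_of_local_lifts SU4capH
    (X := proj ⁻¹' {QuotientGroup.mk g}) (fun a => ⟨_, hmem a⟩) ?_ ?_ ?_ ?_).imp
    fun Φ hΦ a => congrArg Subtype.val (hΦ a)
  · exact continuous_induced_rng.2 ((continuous_const_smul g).comp
      (QuotientGroup.continuous_mk.comp continuous_inclSU4))
  · have h : DSmooth fun a => g • (QuotientGroup.mk (inclSU4 a) : B13) :=
      (dSmooth_smul H g).comp ((dSmooth_mk H).comp dSmooth_inclSU4)
    exact h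
  · intro a b
    rw [Subtype.mk.injEq, smul_left_cancel_iff, QuotientGroup.eq, Subgroup.mem_comap, map_mul,
      map_inv]
  · intro n p hp x
    have hp' : IsPlot fun y => (p y : B13) := hp
    obtain ⟨q, hq, hqp⟩ := exists_isPlotAt_lift_coset hp' x
    have hL : ∀ᶠ y in 𝓝 x, g⁻¹ * q y ∈ SU4U1 := hqp.mono fun y hy => by
      have h1 : proj (p y) = QuotientGroup.mk g := (p y).2
      rw [← hy] at h1
      exact QuotientGroup.eq.1 h1.symm
    obtain ⟨a, ha, haq⟩ := exists_isPlotAt_SU4 ((isPlot_const.isPlotAt x).mul hq) hL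
    refine ⟨a, ha, ?_⟩
    filter_upwards [haq, hqp] with y hy hqp
    refine Subtype.ext ?_
    have h1 : (QuotientGroup.mk (inclSU4 (a y)) : B13) = QuotientGroup.mk (g⁻¹ * q y) :=
      QuotientGroup.eq.2 hy
    change g • (QuotientGroup.mk (inclSU4 (a y)) : B13) = p y
    rw [h1, ← hqp]
    exact congrArg QuotientGroup.mk (mul_inv_cancel_left g (q y))

end Fibre

end Berger
end

open Berger in
theorem proposition4p8 :
    -- `B¹³ → SU(5)/S(U(4) × U(1))` is a homogeneous fibration with fibre `S(U(4) × U(1))/H`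
    IsHomogeneousFibration H SU4U1 H_le ∧
    -- its base is `ℂP⁴`, by `g S(U(4) × U(1)) ↦ [g e₅]`
    (∃ Φ : Diffeo (SU5 ⧸ SU4U1) (ℙ ℂ ((Fin 2 ⊕ Fin 2) ⊕ Unit → ℂ)),
      ∀ g : SU5, ∃ hg : (fun i => g.1 i (Sum.inr ())) ≠ 0,
        Φ.toHomeomorph (QuotientGroup.mk g) =
          Projectivization.mk ℂ (fun i => g.1 i (Sum.inr ())) hg) ∧
    -- `SU(4)/(SU(4) ∩ H) = S(U(4) × U(1))/H`, by the map induced by the inclusion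
    (∃ Φ : Diffeo (SU4 ⧸ SU4capH) (SU4U1 ⧸ H.subgroupOf SU4U1),
      ∀ a : SU4, Φ.toHomeomorph (QuotientGroup.mk a) =
        QuotientGroup.mk (⟨inclSU4 a, inclSU4_mem a⟩ : SU4U1)) ∧
    -- `SU(4)/(SU(4) ∩ H)` is diffeomorphic to `ℝP⁵`
    Nonempty (Diffeo (SU4 ⧸ SU4capH) (ℙ ℝ (Fin 6 → ℝ))) ∧
    -- each fibre is the translate by an element of `SU(5)` of `SU(4)/(SU(4) ∩ H) ⊆ B¹³`
    (∀ g : SU5, ∃ Φ : Diffeo (SU4 ⧸ SU4capH) (proj ⁻¹' {QuotientGroup.mk g}),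
      ∀ a : SU4, (Φ.toHomeomorph (QuotientGroup.mk a) : B13) =
        g • (QuotientGroup.mk (inclSU4 a) : B13)) := by
  obtain ⟨σ, hσ⟩ := exists_localSection
  exact ⟨σ.isHomogeneousFibration hσ H_le isClosed_H isClosed_SU4U1, exists_diffeo_base,
    exists_diffeo_fibre, exists_diffeo_realProjective, exists_diffeo_fibre_smul⟩
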